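/- Let $(R,\mathfrak m)$ be a Noetherian Cohen–Macaulay local ring of dimension $d$ with infinite residue field, let $I$ be an $\mathfrak m$-primary ideal, and let $K\supseteq I$ be an ideal of $R$. Write $\lambda$ for length. A reduction of $I$ is an ideal $J\subseteq I$ with $JI^n=I^{n+1}$ for some $n\ge 0$; it is minimal if it is minimal under inclusion among the reductions of $I$. Assume that $I$ has almost minimal multiplicity with respect to $K$, that is, $\lambda(KI/KJ)=1$ for every minimal reduction $J$ of $I$. Let $G(I)=\bigoplus_{n\ge0}I^n/I^{n+1}$ be the associated graded ring and assume that the grade $\gamma(I)$ of its maximal homogeneous ideal (the supremum of the lengths of regular sequences contained in it) satisfies $\gamma(I)\ge d-1$. Let $e_0(I)$ be the multiplicity of $I$, that is, $d!$ times the coefficient of $n^d$ in the polynomial that agrees with $\lambda(R/I^n)$ for all large $n$. Let $J$ be any minimal reduction of $I$ and let $s=r_J^K(I)=\min\{n\ge0 \mid KI^{n+1}=KJI^n\}$. Then $$\sum_{n\ge0}\lambda(R/KI^n)\,t^n=\frac{\lambda(R/K)+\bigl(e_0(I)-1-\lambda(R/K)\bigr)t+t^{s+1}}{(1-t)^{d+1}}$$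 as formal power series with rational coefficients. -/

import Mathlib

namespace FiberCone

open Polynomial IsLocalRing

universe u

/-- The grade of an ideal `A`: the supremum of the lengths of the regular sequences in `A`. -/
noncomputable def idealGrade {S : Type u} [CommRing S] (A : Ideal S) : ℕ∞ :=
  ⨆ rs : {rs : List S // RingTheory.Sequence.IsRegular S rs ∧ ∀ x ∈ rs, x ∈ A},
    (rs.1.length : ℕ∞)

/-- A Noetherian local ring is Cohen-Macaulay if its depth (the grade of the maximal ideal)
equals its Krull dimension. -/
def IsCohenMacaulayLocal (R : Type u) [CommRing R] [IsLocalRing R] : Prop :=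
  IsNoetherianRing R ∧ ((idealGrade (maximalIdeal R) : ℕ∞) : WithBot ℕ∞) = ringKrullDim R

section

variable {R : Type u} [CommRing R]

/-- The associated graded ring `G(I) = ⨁ I ^ n / I ^ (n + 1)`, realised as the quotient
`R[It] / I R[It]` of the Rees algebra `R[It] = ⨁ I ^ n t ^ n`. -/
abbrev AssocGraded (I : Ideal R) : Type u :=
  reesAlgebra I ⧸ I.map (algebraMap R (reesAlgebra I))

/-- The ideal of the Rees algebra consisting of the elements whose degree zero component
lies in `A`. -/
noncomputable def reesIdealOver (I A : Ideal R) : Ideal (reesAlgebra I) :=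
  A.comap ((Polynomial.constantCoeff : R[X] →+* R).comp (reesAlgebra I).val.toRingHom)

/-- The maximal homogeneous ideal `𝔪 / I ⊕ I / I ^ 2 ⊕ I ^ 2 / I ^ 3 ⊕ ⋯` of `G(I)`. -/
noncomputable def maxHomogeneousIdeal [IsLocalRing R] (I : Ideal R) : Ideal (AssocGraded I) :=
  (reesIdealOver I (maximalIdeal R)).map
    (Ideal.Quotient.mk (I.map (algebraMap R (reesAlgebra I))))

/-- `γ(I)`: the grade of the maximal homogeneous ideal of `G(I)`. -/
noncomputable def gamma [IsLocalRing R] (I : Ideal R) : ℕ∞ :=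
  idealGrade (S := AssocGraded I) (maxHomogeneousIdeal I)

/-- `J` is a reduction of `I`. -/
def IsReduction (J I : Ideal R) : Prop :=
  J ≤ I ∧ ∃ n : ℕ, J * I ^ n = I ^ (n + 1)

/-- `J` is a minimal reduction of `I`: a reduction that is minimal under inclusion. -/
def IsMinimalReduction (J I : Ideal R) : Prop :=
  Minimal (fun L : Ideal R => IsReduction L I) J

/-- `λ(A / B)` for ideals `B ≤ A`. -/
noncomputable def quotLength (A B : Ideal R) : ℕ∞ :=
  Module.length R (A ⧸ Submodule.submoduleOf B A)

/-- `I` has almost minimal multiplicity with respect to `K ⊇ I`: `λ(KI / KJ) = 1` for every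
minimal reduction `J` of `I`. -/
def HasAlmostMinimalMultiplicity (I K : Ideal R) : Prop :=
  I ≤ K ∧ ∀ J : Ideal R, IsMinimalReduction J I → quotLength (K * I) (K * J) = 1

/-- The `K`-reduction number `r_J^K(I) = min {n | K I ^ (n + 1) = K J I ^ n}`. -/
noncomputable def reductionNumber (K J I : Ideal R) : ℕ :=
  sInf {n : ℕ | K * I ^ (n + 1) = K * J * I ^ n}

/-- `λ(R / A)` as a natural number (for ideals `A` of finite colength). -/
noncomputable def colength (A : Ideal R) : ℕ :=
  (Module.length R (R ⧸ A)).toNat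

/-- `P` is the Hilbert polynomial of `I`: it agrees with `n ↦ λ(R / I ^ n)` for large `n`. -/
def IsHilbertPolynomial (I : Ideal R) (P : ℚ[X]) : Prop :=
  ∀ᶠ n : ℕ in Filter.atTop, P.eval (n : ℚ) = (colength (I ^ n) : ℚ)

theorem IsHilbertPolynomial.unique {I : Ideal R} {P Q : ℚ[X]}
    (hP : IsHilbertPolynomial I P) (hQ : IsHilbertPolynomial I Q) : P = Q := by
  obtain ⟨N, hN⟩ := Filter.eventually_atTop.1 (hP.and hQ)
  refine Polynomial.eq_of_infinite_eval_eq P Q ?_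
  refine ((Set.Ici_infinite N).image (Nat.cast_injective (R := ℚ)).injOn).mono ?_
  rintro _ ⟨n, hn, rfl⟩
  exact (hN n hn).1.trans (hN n hn).2.symm

open Classical in
/-- The Hilbert polynomial `P(I, n)` of `I` (the unique polynomial of the preceding definition
when there is one, as is the case for an `𝔪`-primary ideal in a Noetherian local ring). -/
noncomputable def hilbertPolynomial (I : Ideal R) : ℚ[X] :=
  if h : ∃ P : ℚ[X], IsHilbertPolynomial I P then h.choose else 0

theorem IsHilbertPolynomial.hilbertPolynomial_eq {I : Ideal R} {P : ℚ[X]}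
    (hP : IsHilbertPolynomial I P) : hilbertPolynomial I = P := by
  have h : ∃ P : ℚ[X], IsHilbertPolynomial I P := ⟨P, hP⟩
  rw [hilbertPolynomial, dif_pos h]
  exact h.choose_spec.unique hP

/-- The multiplicity `e_0(I)` in a local ring of dimension `d`. It is the coefficient of
`binom (n + d - 1) d` in the expansion
`P(I, n) = e_0 binom (n + d - 1) d - e_1 binom (n + d - 2) (d - 1) + ⋯ + (-1) ^ d e_d`,
that is, `d!` times the coefficient of `n ^ d` in `P(I, n)`. -/
noncomputable def hilbertMultiplicity (I : Ideal R) (d : ℕ) : ℚ :=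
  (d.factorial : ℚ) * (hilbertPolynomial I).coeff d

/-- The Hilbert function `H_K(I, n) = λ(R / K I ^ n)`. -/
noncomputable def hilbertFunction (K I : Ideal R) (n : ℕ) : ℕ :=
  colength (K * I ^ n)

end

end FiberCone

/-! Let k be the residue field. A minimal reduction J is generated by a system of parameters x_1, …,
x_d (`exists_generators_of_isMinimalReduction`), and this is a quasi-regular system because R is
Cohen–Macaulay (`isQuasiRegularOn_of_isCohenMacaulayLocal`). Hence λ(R/KJ^n) is explicit, and e_0(I)
= λ(R/J) (`hilbertMultiplicity_eq_colength`). Almost minimal multiplicity gives KI = KJ + (ab) with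
a ∈ K, b ∈ I and 𝔪ab ⊆ KJ. In the chain KJ^n ⊆ KIJ^{n-1} ⊆ … ⊆ KI^n each factor KI^{j+1}J^m /
KI^jJ^{m+1} is therefore a k-space spanned by the products of ab^{j+1} with the monomials of degree
m in x. Only its dimension has to be found.

For fixed j these factors form a cyclic graded module over k[T_1, …, T_d]. It vanishes for j ≥ s.
For j < s it is free (`map_residue_eq_zero_of_mul_mem`), so the factor of degree m has dimension
binom(d+m-1, m). Summing over the chain gives λ(R/KI^n) (`hilbertFunction_add_sum`), and the
generating function follows (`mk_mul_one_sub_X_pow_of_add_sum`).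

The freeness is the heart of the matter. Let N = ⨁ KJ^n t^n, let N_i be N enlarged by (bt)^l·abt for
l < i, and let σ be the first index for which the cyclic module N_{σ+1}/N_σ is not free, hence
torsion. At a height one prime of k[T] the saturation of N_σ is generated modulo N by σ elements,
and bt maps this saturation to itself. The Cayley–Hamilton theorem then puts (bt)^σ·abt into N_σ
locally. Since N_σ arises from N by free extensions, membership at all height one primes implies
membership (`pow_mul_mem_of_torsion`). In degree σ+1 this says ab^{σ+1} ∈ KI^σJ, which is impossible
for σ < s by the minimality of s. -/

/-! ### Cyclic extensions of a module: torsion forces vanishing. -/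

section CyclicFiltration

variable {B D M : Type*} [CommRing B] [CommRing D] [CommRing M] [Algebra B M]

/-- The submodule `N + B c + B b c + ⋯ + B b ^ (i - 1) c`. -/
def cyclicFiltration (N : Submodule B M) (b c : M) : ℕ → Submodule B M
  | 0 => N
  | i + 1 => cyclicFiltration N b c i ⊔ Submodule.span B {b ^ i * c}

/-- The saturation of `N` with respect to the scalars outside the kernel of `ρ`. -/
def saturation [IsDomain D] (ρ : B →+* D) (N : Submodule B M) : Submodule B M where
  carrier := {h | ∃ f, ρ f ≠ 0 ∧ f • h ∈ N}
  zero_mem' := ⟨1, by simp, by simp⟩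
  add_mem' := by
    rintro x y ⟨f, hf, hx⟩ ⟨g, hg, hy⟩
    refine ⟨f * g, by simp [hf, hg], ?_⟩
    rw [smul_add]
    refine N.add_mem ?_ ?_
    · rw [mul_comm, mul_smul]; exact N.smul_mem _ hx
    · rw [mul_smul]; exact N.smul_mem _ hy
  smul_mem' := by
    rintro a x ⟨f, hf, hx⟩
    exact ⟨f, hf, by rw [smul_comm]; exact N.smul_mem _ hx⟩

theorem mem_saturation [IsDomain D] {ρ : B →+* D} {N : Submodule B M} {h : M} :
    h ∈ saturation ρ N ↔ ∃ f, ρ f ≠ 0 ∧ f • h ∈ N := Iff.rfl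

theorem le_saturation [IsDomain D] (ρ : B →+* D) (N : Submodule B M) : N ≤ saturation ρ N :=
  fun h hh => ⟨1, by simp, by simpa using hh⟩

theorem saturation_saturated [IsDomain D] {ρ : B →+* D} {N : Submodule B M} {f : B} {h : M}
    (hf : ρ f ≠ 0) (hh : f • h ∈ saturation ρ N) : h ∈ saturation ρ N := by
  obtain ⟨g, hg, hgh⟩ := hh
  exact ⟨g * f, by simp [hf, hg], by rwa [mul_smul]⟩

theorem saturation_mono [IsDomain D] {ρ : B →+* D} {N N' : Submodule B M} (h : N ≤ N') :
    saturation ρ N ≤ saturation ρ N' := fun _ ⟨f, hf, hh⟩ => ⟨f, hf, h hh⟩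

section Basic

variable (N : Submodule B M) (b c : M)

theorem cyclicFiltration_mono : Monotone (cyclicFiltration N b c) :=
  monotone_nat_of_le_succ fun _ => le_sup_left

theorem pow_mul_mem_cyclicFiltration (i : ℕ) : b ^ i * c ∈ cyclicFiltration N b c (i + 1) :=
  Submodule.mem_sup_right (Submodule.mem_span_singleton_self _)

variable {N b c}

theorem mem_cyclicFiltration_succ {i : ℕ} {y : M} :
    y ∈ cyclicFiltration N b c (i + 1) ↔
      ∃ α : B, y - α • (b ^ i * c) ∈ cyclicFiltration N b c i := by
  constructor
  · intro hy
    obtain ⟨n, hn, z, hz, rfl⟩ := Submodule.mem_sup.1 hy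
    obtain ⟨α, rfl⟩ := Submodule.mem_span_singleton.1 hz
    exact ⟨α, by simpa using hn⟩
  · rintro ⟨α, hα⟩
    have := (cyclicFiltration N b c (i + 1)).add_mem (cyclicFiltration_mono N b c (Nat.le_succ i) hα)
      (Submodule.smul_mem _ α (pow_mul_mem_cyclicFiltration N b c i))
    simpa using this

/-- Multiplication by `b` does not preserve `N`; it costs one step of the filtration. This shift is
what the Cayley–Hamilton argument has to keep track of. -/
theorem mul_mem_cyclicFiltration (hb : ∀ y ∈ N, b * y ∈ cyclicFiltration N b c 1) :
    ∀ (i : ℕ) {y : M}, y ∈ cyclicFiltration N b c i → b * y ∈ cyclicFiltration N b c (i + 1)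
  | 0, y, hy => hb y hy
  | i + 1, y, hy => by
    obtain ⟨α, hα⟩ := mem_cyclicFiltration_succ.1 hy
    have h := mul_mem_cyclicFiltration hb i hα
    refine mem_cyclicFiltration_succ.2 ⟨α, ?_⟩
    rwa [mul_sub, mul_smul_comm, ← mul_assoc, ← pow_succ'] at h

theorem pow_mul_mem_cyclicFiltration_of_mem (hb : ∀ y ∈ N, b * y ∈ cyclicFiltration N b c 1)
    (k : ℕ) {y : M} (hy : y ∈ N) : b ^ k * y ∈ cyclicFiltration N b c k := by
  induction k with
  | zero => simpa [cyclicFiltration] using hy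
  | succ k ih =>
    rw [pow_succ', mul_assoc]
    exact mul_mem_cyclicFiltration hb k ih

/-- This makes each quotient of consecutive steps a cyclic module over `D`: the kernel of `ρ` sends
`c` into `N`, and `b ^ i` moves `N` into step `i`. -/
theorem smul_pow_mul_mem_of_ker {ρ : B →+* D} (hb : ∀ y ∈ N, b * y ∈ cyclicFiltration N b c 1)
    (hker : ∀ f, ρ f = 0 → f • c ∈ N) (i : ℕ) {f : B} (hf : ρ f = 0) :
    f • (b ^ i * c) ∈ cyclicFiltration N b c i := by
  rw [← mul_smul_comm]
  exact pow_mul_mem_cyclicFiltration_of_mem hb i (hker f hf)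

theorem smul_mem_cyclicFiltration_of_ker {ρ : B →+* D}
    (hb : ∀ y ∈ N, b * y ∈ cyclicFiltration N b c 1)
    (hker : ∀ f, ρ f = 0 → f • c ∈ N) (i : ℕ) {f : B} (hf : ρ f = 0) {y : M}
    (hy : y ∈ cyclicFiltration N b c (i + 1)) : f • y ∈ cyclicFiltration N b c i := by
  obtain ⟨α, hα⟩ := mem_cyclicFiltration_succ.1 hy
  have h1 := Submodule.smul_mem _ f hα
  have h2 := Submodule.smul_mem _ α (smul_pow_mul_mem_of_ker hb hker i hf)
  rw [smul_sub, smul_comm f α] at h1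
  simpa using Submodule.add_mem _ h1 h2

end Basic

/-- A rank one torsion-free quotient `G / F` is generated by one element at a height one prime. -/
theorem exists_local_generator [IsDomain D] [UniqueFactorizationMonoid D]
    {ρ : B →+* D} (hρ : Function.Surjective ρ) {F G : Submodule B M} [IsNoetherian B G]
    (hF : ∀ f h, ρ f ≠ 0 → f • h ∈ F → h ∈ F)
    (hker : ∀ f h, ρ f = 0 → h ∈ G → f • h ∈ F)
    (hrank : ∀ g ∈ G, ∀ h ∈ G, ∃ α β : B, (ρ α ≠ 0 ∨ ρ β ≠ 0) ∧ α • h - β • g ∈ F)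
    {π : D} (hπ : Prime π) :
    ∃ g ∈ G, ∀ h ∈ G, ∃ e, ¬ π ∣ ρ e ∧ ∃ β : B, e • h - β • g ∈ F := by
  have hrank' : ∀ g ∈ G, ∀ h ∈ G, ∃ α β : B, (¬ π ∣ ρ α ∨ ¬ π ∣ ρ β) ∧ α • h - β • g ∈ F := by
    intro g hg h hh
    obtain ⟨α, β, hne, hmem⟩ := hrank g hg h hh
    -- The common factor of the two coefficients can be cancelled because `F` is saturated;
    -- afterwards `π` cannot divide both.
    obtain ⟨a', b', c', hrel, ha, hb⟩ :
        ∃ a' b' c' : D, IsRelPrime a' b' ∧ ρ α = c' * a' ∧ ρ β = c' * b' := by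
      rcases hne with h0 | h0
      · obtain ⟨a', b', c', hrel, ha, hb⟩ :=
          UniqueFactorizationMonoid.exists_reduced_factors (ρ α) h0 (ρ β)
        exact ⟨a', b', c', hrel, ha.symm, hb.symm⟩
      · obtain ⟨a', b', c', hrel, ha, hb⟩ :=
          UniqueFactorizationMonoid.exists_reduced_factors (ρ β) h0 (ρ α)
        exact ⟨b', a', c', hrel.symm, hb.symm, ha.symm⟩
    have hc : c' ≠ 0 := by
      rintro rfl
      simp_all
    obtain ⟨a, rfl⟩ := hρ a'
    obtain ⟨b, rfl⟩ := hρ b'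
    obtain ⟨c, rfl⟩ := hρ c'
    refine ⟨a, b, ?_, hF c _ hc ?_⟩
    · by_contra hcon
      push Not at hcon
      exact hπ.not_isUnit (hrel hcon.1 hcon.2)
    · have h1 : (c * a - α) • h ∈ F := hker _ _ (by simp [ha]) hh
      have h2 : (c * b - β) • g ∈ F := hker _ _ (by simp [hb]) hg
      have : c • (a • h - b • g) = (c * a - α) • h - (c * b - β) • g + (α • h - β • g) := by
        simp only [sub_smul, mul_smul, smul_sub]; abel
      rw [this]
      exact F.add_mem (F.sub_mem h1 h2) hmem
  let V : M → Submodule B M := fun g =>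
    { carrier := {h | ∃ e, ¬ π ∣ ρ e ∧ ∃ β : B, e • h - β • g ∈ F}
      zero_mem' := ⟨1, by simpa using hπ.not_isUnit ∘ isUnit_of_dvd_one, 0, by simp⟩
      add_mem' := by
        rintro x y ⟨e, he, β, hx⟩ ⟨e', he', β', hy⟩
        refine ⟨e * e', ?_, e' * β + e * β', ?_⟩
        · rw [map_mul]; exact fun h => (hπ.dvd_or_dvd h).elim he he'
        · have : (e * e') • (x + y) - (e' * β + e * β') • g =
              e' • (e • x - β • g) + e • (e' • y - β' • g) := by
            simp only [smul_add, smul_sub, add_smul, mul_smul, smul_comm e' e]; abel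
          rw [this]
          exact F.add_mem (F.smul_mem _ hx) (F.smul_mem _ hy)
      smul_mem' := by
        rintro a x ⟨e, he, β, hx⟩
        refine ⟨e, he, a * β, ?_⟩
        have := F.smul_mem a hx
        rwa [smul_sub, smul_comm, ← mul_smul a β] at this }
  have hone : ¬ π ∣ ρ 1 := by simpa using hπ.not_isUnit ∘ isUnit_of_dvd_one
  -- `V g` is the part of the module generated by `g` locally at `π`. Over the discrete valuation
  -- ring `D_π` these parts are totally ordered, so a maximal one is everything.
  obtain ⟨S, ⟨g, hg, rfl⟩, hmax⟩ := set_has_maximal_iff_noetherian.2 (inferInstance : IsNoetherian B G)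
    ((fun g => (V g).comap G.subtype) '' (G : Set M)) ⟨_, 0, G.zero_mem, rfl⟩
  refine ⟨g, hg, fun h hh => ?_⟩
  obtain ⟨α, β, hor, hmem⟩ := hrank' g hg h hh
  rcases hor with hα | hβ
  · exact ⟨α, hα, β, hmem⟩
  · have hle : (V g).comap G.subtype ≤ (V h).comap G.subtype := by
      rintro x ⟨e, he, γ, hx⟩
      refine ⟨β * e, ?_, γ * α, ?_⟩
      · rw [map_mul]; exact fun h => (hπ.dvd_or_dvd h).elim hβ he
      · have : (β * e) • (x : M) - (γ * α) • h =
            β • (e • (x : M) - γ • g) - γ • (α • h - β • g) := by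
          simp only [smul_sub, mul_smul, smul_comm β γ]; abel
        change (β * e) • (x : M) - (γ * α) • h ∈ F
        rw [this]
        exact F.sub_mem (F.smul_mem _ hx) (F.smul_mem _ hmem)
    have hge := not_lt_iff_le_imp_ge.1 (hmax _ ⟨h, hh, rfl⟩) hle
    exact hge (show (⟨h, hh⟩ : G) ∈ (V h).comap G.subtype from ⟨1, hone, 1, by simp⟩)

/-- The saturations of consecutive steps have torsion-free quotients of rank at most one, so each
step adds a single local generator at `π`. -/
theorem exists_local_generators [IsDomain D] [UniqueFactorizationMonoid D]
    {ρ : B →+* D} (hρ : Function.Surjective ρ) {N : Submodule B M} {b c : M}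
    (hb : ∀ y ∈ N, b * y ∈ cyclicFiltration N b c 1)
    (hker : ∀ f, ρ f = 0 → f • c ∈ N)
    (hN : ∀ f h, ρ f ≠ 0 → f • h ∈ N → h ∈ N) {π : D} (hπ : Prime π) (i : ℕ)
    (hnoeth : IsNoetherian B (saturation ρ (cyclicFiltration N b c i))) :
    ∃ g : Fin i → M, (∀ j, g j ∈ saturation ρ (cyclicFiltration N b c i)) ∧
      ∀ h ∈ saturation ρ (cyclicFiltration N b c i), ∃ e, ¬ π ∣ ρ e ∧
        ∃ β : Fin i → B, e • h - ∑ j, β j • g j ∈ N := by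
  have hone : ¬ π ∣ ρ 1 := by simpa using hπ.not_isUnit ∘ isUnit_of_dvd_one
  induction i with
  | zero =>
    refine ⟨0, fun j => j.elim0, ?_⟩
    rintro h ⟨f, hf, hh⟩
    exact ⟨1, hone, 0, by simpa using hN f h hf hh⟩
  | succ i ih =>
    have hle : saturation ρ (cyclicFiltration N b c i) ≤
        saturation ρ (cyclicFiltration N b c (i + 1)) :=
      saturation_mono (cyclicFiltration_mono N b c (Nat.le_succ i))
    obtain ⟨g, hg, hspan⟩ := ih (isNoetherian_of_le hle)
    obtain ⟨g0, hg0, hspan0⟩ := exists_local_generator (F := saturation ρ (cyclicFiltration N b c i))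
      (G := saturation ρ (cyclicFiltration N b c (i + 1))) hρ
      (fun f h hf hh => saturation_saturated hf hh)
      (by
        rintro f h hf ⟨f', hf', hh⟩
        refine ⟨f', hf', ?_⟩
        rw [smul_comm]
        exact smul_mem_cyclicFiltration_of_ker hb hker i hf hh)
      (by
        rintro g ⟨f, hf, hg⟩ h ⟨f', hf', hh⟩
        obtain ⟨φ, hφ⟩ := mem_cyclicFiltration_succ.1 hg
        obtain ⟨φ', hφ'⟩ := mem_cyclicFiltration_succ.1 hh
        by_cases h0 : ρ φ = 0
        · refine ⟨0, 1, Or.inr (by simp), ?_⟩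
          rw [zero_smul, one_smul, zero_sub, neg_mem_iff]
          refine ⟨f, hf, ?_⟩
          simpa using Submodule.add_mem _ hφ (smul_pow_mul_mem_of_ker hb hker i h0)
        · refine ⟨φ * f', φ' * f, Or.inl (by simp [h0, hf']), le_saturation _ _ ?_⟩
          have := Submodule.sub_mem _ (Submodule.smul_mem _ φ hφ') (Submodule.smul_mem _ φ' hφ)
          simpa only [smul_sub, mul_smul, smul_comm φ φ', sub_sub_sub_cancel_right] using this) hπ
    refine ⟨Fin.cons g0 g, ?_, ?_⟩
    · intro j
      refine Fin.cases ?_ (fun j => ?_) j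
      · exact hg0
      · exact hle (hg j)
    · intro h hh
      obtain ⟨e, he, β, hβ⟩ := hspan0 h hh
      obtain ⟨e', he', γ, hγ⟩ := hspan _ hβ
      refine ⟨e' * e, ?_, Fin.cons (e' * β) γ, ?_⟩
      · rw [map_mul]; exact fun h => (hπ.dvd_or_dvd h).elim he' he
      · rw [Fin.sum_univ_succ]
        simp only [Fin.cons_zero, Fin.cons_succ]
        rw [smul_sub] at hγ
        rwa [mul_smul, mul_smul, ← sub_sub]

/-- A Cayley–Hamilton argument at the prime `π`: multiplication by `b` on the saturation of step `σ`
is given modulo `N` by a σ × σ matrix, whose characteristic polynomial is monic of degree `σ`.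
Applied to `c`, its lower terms already lie in step `σ`, so the leading term does as well, up to a
scalar prime to `π`. -/
theorem exists_smul_pow_mul_mem [IsDomain D] [UniqueFactorizationMonoid D]
    {ρ : B →+* D} (hρ : Function.Surjective ρ) {N : Submodule B M} {b c : M}
    (hb : ∀ y ∈ N, b * y ∈ cyclicFiltration N b c 1)
    (hker : ∀ f, ρ f = 0 → f • c ∈ N)
    (hN : ∀ f h, ρ f ≠ 0 → f • h ∈ N → h ∈ N) (σ : ℕ)
    [IsNoetherian B (saturation ρ (cyclicFiltration N b c σ))]
    (htor : ∃ f, ρ f ≠ 0 ∧ f • (b ^ σ * c) ∈ cyclicFiltration N b c σ)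
    {π : D} (hπ : Prime π) :
    ∃ e, ¬ π ∣ ρ e ∧ e • (b ^ σ * c) ∈ cyclicFiltration N b c σ := by
  classical
  have : Nontrivial B := ρ.domain_nontrivial
  have hmono := cyclicFiltration_mono N b c
  obtain ⟨g, hg, hspan⟩ := exists_local_generators hρ hb hker hN hπ σ inferInstance
  have hc : c ∈ saturation ρ (cyclicFiltration N b c σ) := by
    rcases Nat.eq_zero_or_pos σ with rfl | hσ
    · simpa [mem_saturation] using htor
    · exact le_saturation _ _ (hmono hσ (by simpa using pow_mul_mem_cyclicFiltration N b c 0))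
  -- Here the torsion hypothesis enters: `b` maps step `σ` into step `σ + 1`, which has the same
  -- saturation.
  have hbF : ∀ h ∈ saturation ρ (cyclicFiltration N b c σ),
      b * h ∈ saturation ρ (cyclicFiltration N b c σ) := by
    rintro h ⟨f, hf, hh⟩
    refine saturation_saturated hf ?_
    rw [← mul_smul_comm]
    obtain ⟨α, hα⟩ := mem_cyclicFiltration_succ.1 (mul_mem_cyclicFiltration hb σ hh)
    have := Submodule.add_mem _ (le_saturation ρ _ hα) (Submodule.smul_mem _ α
      (mem_saturation.2 htor))
    simpa using this
  choose e he β hβ using fun j => hspan _ (hbF _ (hg j))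
  obtain ⟨e', he', γ, hγ⟩ := hspan c hc
  -- A common denominator prime to `π`, so that `E • b` acts on the generators through a matrix with
  -- entries in `B`.
  set E := ∏ j, e j with hE
  have hEπ : ¬ π ∣ ρ E := by
    rw [hE, map_prod, hπ.dvd_finsetProd_iff]
    push Not
    exact fun j _ => he j
  have hdvd : ∀ j, ∃ q, E = e j * q := fun j => Finset.dvd_prod_of_mem e (Finset.mem_univ j)
  choose q hq using hdvd
  let C : Matrix (Fin σ) (Fin σ) B := Matrix.of fun j l => q j * β j l
  have hC : ∀ j, (E • b) * g j - ∑ l, C j l • g l ∈ N := by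
    intro j
    have := N.smul_mem (q j) (hβ j)
    simpa only [C, Matrix.of_apply, hq j, smul_sub, Finset.smul_sum, mul_smul, smul_mul_assoc,
      smul_comm (q j) (e j)] using this
  -- The error grows with the power: as `b` shifts the filtration, the matrix identity for the
  -- `k`-th power holds only modulo step `k`. Degree `σ` is just small enough for step `σ`.
  have hpow : ∀ k j, (E • b) ^ k * g j - ∑ l, (C ^ k) j l • g l ∈ cyclicFiltration N b c k := by
    intro k
    induction k with
    | zero => intro j; simp [Matrix.one_apply, ite_smul]
    | succ k ih =>
      intro j
      have h1 : (E • b) * ((E • b) ^ k * g j - ∑ l, (C ^ k) j l • g l) ∈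
          cyclicFiltration N b c (k + 1) := by
        rw [smul_mul_assoc]
        exact Submodule.smul_mem _ _ (mul_mem_cyclicFiltration hb k (ih j))
      have h2 : ∑ l, (C ^ k) j l • ((E • b) * g l - ∑ m, C l m • g m) ∈
          cyclicFiltration N b c (k + 1) :=
        Submodule.sum_mem _ fun l _ => Submodule.smul_mem _ _ (hmono (Nat.zero_le _) (hC l))
      have h3 : ∑ l, (C ^ (k + 1)) j l • g l = ∑ l, (C ^ k) j l • ∑ m, C l m • g m := by
        simp_rw [pow_succ, Matrix.mul_apply, Finset.sum_smul, Finset.smul_sum, mul_smul]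
        exact Finset.sum_comm
      have h4 := Submodule.add_mem _ h1 h2
      rw [h3]
      convert h4 using 1
      rw [mul_sub, Finset.mul_sum, pow_succ', mul_assoc]
      simp only [smul_sub, Finset.sum_sub_distrib, mul_smul_comm]
      abel
  have hdeg : C.charpoly.natDegree = σ := by simp [C.charpoly_natDegree_eq_dim]
  have hcoeff : C.charpoly.coeff σ = 1 := by
    have := C.charpoly_monic.coeff_natDegree
    rwa [hdeg] at this
  have hCH : ∑ k ∈ Finset.range (σ + 1), C.charpoly.coeff k • C ^ k = 0 := by
    have := C.aeval_self_charpoly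
    rwa [Polynomial.aeval_eq_sum_range, hdeg] at this
  have hann : ∀ j, (∑ k ∈ Finset.range (σ + 1), C.charpoly.coeff k • (E • b) ^ k) * g j ∈
      cyclicFiltration N b c σ := by
    intro j
    have h1 : ∑ k ∈ Finset.range (σ + 1), C.charpoly.coeff k •
        ((E • b) ^ k * g j - ∑ l, (C ^ k) j l • g l) ∈ cyclicFiltration N b c σ :=
      Submodule.sum_mem _ fun k hk => Submodule.smul_mem _ _
        (hmono (Nat.lt_succ_iff.1 (Finset.mem_range.1 hk)) (hpow k j))
    have h2 : ∑ k ∈ Finset.range (σ + 1), C.charpoly.coeff k • ∑ l, (C ^ k) j l • g l = 0 := by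
      simp_rw [Finset.smul_sum]
      rw [Finset.sum_comm]
      refine Finset.sum_eq_zero fun l _ => ?_
      simp_rw [← mul_smul]
      rw [← Finset.sum_smul]
      have := congrFun (congrFun hCH j) l
      simp only [Matrix.sum_apply, Matrix.smul_apply, smul_eq_mul, Matrix.zero_apply] at this
      rw [this, zero_smul]
    simp_rw [smul_sub] at h1
    rw [Finset.sum_sub_distrib, h2, sub_zero] at h1
    simpa only [Finset.sum_mul, smul_mul_assoc] using h1
  have hfin : (∑ k ∈ Finset.range (σ + 1), C.charpoly.coeff k • (E • b) ^ k) * (e' • c) ∈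
      cyclicFiltration N b c σ := by
    have h1 : (∑ k ∈ Finset.range (σ + 1), C.charpoly.coeff k • (E • b) ^ k) *
        (e' • c - ∑ j, γ j • g j) ∈ cyclicFiltration N b c σ := by
      rw [Finset.sum_mul]
      refine Submodule.sum_mem _ fun k hk => ?_
      rw [smul_mul_assoc, smul_pow, smul_mul_assoc]
      exact Submodule.smul_mem _ _ (Submodule.smul_mem _ _
        (hmono (Nat.lt_succ_iff.1 (Finset.mem_range.1 hk))
          (pow_mul_mem_cyclicFiltration_of_mem hb k hγ)))
    have h2 : (∑ k ∈ Finset.range (σ + 1), C.charpoly.coeff k • (E • b) ^ k) *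
        (∑ j, γ j • g j) ∈ cyclicFiltration N b c σ := by
      rw [Finset.mul_sum]
      refine Submodule.sum_mem _ fun j _ => ?_
      rw [mul_smul_comm]
      exact Submodule.smul_mem _ _ (hann j)
    have := Submodule.add_mem _ h1 h2
    rwa [← mul_add, sub_add_cancel] at this
  refine ⟨E ^ σ * e', ?_, ?_⟩
  · rw [map_mul, map_pow]
    exact fun h => (hπ.dvd_or_dvd h).elim (fun h => hEπ (hπ.dvd_of_dvd_pow h)) he'
  · rw [Finset.sum_range_succ, add_mul, hcoeff, one_smul] at hfin
    have h1 : (∑ k ∈ Finset.range σ, C.charpoly.coeff k • (E • b) ^ k) * (e' • c) ∈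
        cyclicFiltration N b c σ := by
      rw [Finset.sum_mul]
      refine Submodule.sum_mem _ fun k hk => ?_
      rw [smul_mul_assoc, smul_pow, smul_mul_assoc, mul_smul_comm]
      exact Submodule.smul_mem _ _ (Submodule.smul_mem _ _ (Submodule.smul_mem _ _
        (hmono (Finset.mem_range.1 hk) (pow_mul_mem_cyclicFiltration N b c k))))
    have h2 := Submodule.sub_mem _ hfin h1
    rw [add_sub_cancel_left, smul_pow, smul_mul_assoc, mul_smul_comm] at h2
    rwa [mul_smul]

/-- A depth two property, inherited from `N` through extensions by free `D`-modules of rank one: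
since `ρ p` is prime and does not divide `ρ g`, the relation g·α = p·β between leading coefficients
forces α to be divisible by p in `D`. -/
theorem mem_cyclicFiltration_of_smul_mem [IsDomain D]
    {ρ : B →+* D} (hρ : Function.Surjective ρ) {N : Submodule B M} {b c : M}
    (hb : ∀ y ∈ N, b * y ∈ cyclicFiltration N b c 1)
    (hker : ∀ f, ρ f = 0 → f • c ∈ N)
    (hN : ∀ f h, ρ f ≠ 0 → f • h ∈ N → h ∈ N) (i : ℕ)
    (hfree : ∀ j < i, ∀ f : B, f • (b ^ j * c) ∈ cyclicFiltration N b c j → ρ f = 0)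
    {p g : B} (hp : Prime (ρ p)) (hg : ¬ ρ p ∣ ρ g) {w : M}
    (hpw : p • w ∈ cyclicFiltration N b c i) (hgw : g • w ∈ cyclicFiltration N b c i) :
    w ∈ cyclicFiltration N b c i := by
  induction i generalizing w with
  | zero => exact hN p w hp.ne_zero hpw
  | succ i ih =>
    obtain ⟨α, hα⟩ := mem_cyclicFiltration_succ.1 hpw
    obtain ⟨β, hβ⟩ := mem_cyclicFiltration_succ.1 hgw
    have hrel : ρ g * ρ α = ρ p * ρ β := by
      have h1 := Submodule.sub_mem _ (Submodule.smul_mem _ p hβ) (Submodule.smul_mem _ g hα)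
      have h2 : p • (g • w - β • (b ^ i * c)) - g • (p • w - α • (b ^ i * c)) =
          (g * α - p * β) • (b ^ i * c) := by
        simp only [smul_sub, mul_smul, sub_smul, smul_comm p g]; abel
      rw [h2] at h1
      have := hfree i (Nat.lt_succ_self i) _ h1
      rw [map_sub, map_mul, map_mul] at this
      exact sub_eq_zero.1 this
    obtain ⟨α', hα'⟩ := (hp.dvd_or_dvd ⟨_, hrel⟩).resolve_left hg
    obtain ⟨α', rfl⟩ := hρ α'
    have hβ' : ρ β = ρ g * ρ α' := by
      refine mul_left_cancel₀ hp.ne_zero ?_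
      rw [← hrel, hα']; ring
    refine mem_cyclicFiltration_succ.2 ⟨α', ih (fun j hj => hfree j (hj.trans (Nat.lt_succ_self i)))
      ?_ ?_⟩
    · have h1 := Submodule.add_mem _ hα (smul_pow_mul_mem_of_ker hb hker i
        (f := α - p * α') (by simp [hα']))
      convert h1 using 1
      simp only [smul_sub, mul_smul, sub_smul]; abel
    · have h1 := Submodule.add_mem _ hβ (smul_pow_mul_mem_of_ker hb hker i
        (f := β - g * α') (by simp [hβ']))
      convert h1 using 1
      simp only [smul_sub, mul_smul, sub_smul]; abel

/-- The annihilator of the class of b^σ c is nonzero and, by `exists_smul_pow_mul_mem`, contained in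
no height one prime. The depth two property then removes the prime factors of an annihilating
element one at a time. -/
theorem pow_mul_mem_of_torsion [IsDomain D] [UniqueFactorizationMonoid D]
    {ρ : B →+* D} (hρ : Function.Surjective ρ) {N : Submodule B M} {b c : M}
    (hb : ∀ y ∈ N, b * y ∈ cyclicFiltration N b c 1)
    (hker : ∀ f, ρ f = 0 → f • c ∈ N)
    (hN : ∀ f h, ρ f ≠ 0 → f • h ∈ N → h ∈ N) (σ : ℕ)
    [IsNoetherian B (saturation ρ (cyclicFiltration N b c σ))]
    (hfree : ∀ j < σ, ∀ f : B, f • (b ^ j * c) ∈ cyclicFiltration N b c j → ρ f = 0)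
    (htor : ∃ f, ρ f ≠ 0 ∧ f • (b ^ σ * c) ∈ cyclicFiltration N b c σ) :
    b ^ σ * c ∈ cyclicFiltration N b c σ := by
  have key : ∀ q : D, q ≠ 0 → ∀ f, ρ f = q → ∀ α : B,
      f • α • (b ^ σ * c) ∈ cyclicFiltration N b c σ →
        α • (b ^ σ * c) ∈ cyclicFiltration N b c σ := by
    intro q
    refine UniqueFactorizationMonoid.induction_on_prime q (fun h => absurd rfl h) ?_ ?_
    · intro u hu _ f hf α hα
      obtain ⟨v, hv⟩ := hu.exists_right_inv
      obtain ⟨v, rfl⟩ := hρ v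
      have h1 := Submodule.smul_mem _ v hα
      have h2 := Submodule.smul_mem _ α (smul_pow_mul_mem_of_ker hb hker σ
        (f := 1 - v * f) (by simp [hf, mul_comm (ρ v), hv]))
      convert Submodule.add_mem _ h1 h2 using 1
      simp only [mul_smul, sub_smul, one_smul, smul_sub, smul_comm α]; abel
    · intro q π hq hπ ih _ f hf α hα
      obtain ⟨p, rfl⟩ := hρ π
      obtain ⟨f', rfl⟩ := hρ q
      obtain ⟨g, hg, hgm⟩ := exists_smul_pow_mul_mem hρ hb hker hN σ htor hπ
      refine ih hq f' rfl α (mem_cyclicFiltration_of_smul_mem hρ hb hker hN σ hfree hπ hg ?_ ?_)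
      · have h2 := Submodule.smul_mem _ α (smul_pow_mul_mem_of_ker hb hker σ
          (f := p * f' - f) (by simp [hf]))
        convert Submodule.add_mem _ hα h2 using 1
        simp only [mul_smul, sub_smul, smul_sub, smul_comm α]; abel
      · have := Submodule.smul_mem _ (f' * α) hgm
        convert this using 1
        simp only [mul_smul, smul_comm g]
  obtain ⟨f, hf, hfm⟩ := htor
  simpa using key _ hf f rfl 1 (by simpa using hfm)

end CyclicFiltration

/-! ### Forms, quasi-regular families and the Rees evaluation. -/

section Forms

open MvPolynomial

variable {ι R : Type*} [CommRing R]

theorem weight_one_eq_degree (m : ι →₀ ℕ) : Finsupp.weight (1 : ι → ℕ) m = m.degree := by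
  rw [show (1 : ι → ℕ) = fun _ => 1 from rfl, ← Finsupp.degree_eq_weight_one]

theorem degree_eq_of_isHomogeneous {n : ℕ} {F : MvPolynomial ι R} (hF : F.IsHomogeneous n)
    {m : ι →₀ ℕ} (hm : coeff m F ≠ 0) : m.degree = n := by
  rw [← weight_one_eq_degree]; exact hF hm

/-- `F` is a form of degree `n` in the variables from `s`. -/
def IsFormOn (s : Set ι) (n : ℕ) (F : MvPolynomial ι R) : Prop :=
  F.IsHomogeneous n ∧ ∀ m, coeff m F ≠ 0 → ∀ i ∉ s, m i = 0

theorem IsFormOn.add {s : Set ι} {n : ℕ} {F G : MvPolynomial ι R} (hF : IsFormOn s n F)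
    (hG : IsFormOn s n G) : IsFormOn s n (F + G) := by
  refine ⟨hF.1.add hG.1, fun m hm i hi => ?_⟩
  by_cases h : coeff m F = 0
  · refine hG.2 m (fun h' => hm ?_) i hi
    rw [coeff_add, h, h', add_zero]
  · exact hF.2 m h i hi

theorem IsFormOn.C_mul {s : Set ι} {n : ℕ} {F : MvPolynomial ι R} (hF : IsFormOn s n F) (a : R) :
    IsFormOn s n (C a * F) := by
  refine ⟨by simpa using (isHomogeneous_C ι a).mul hF.1, fun m hm i hi => hF.2 m (fun h => hm ?_) i hi⟩
  rw [coeff_C_mul, h, mul_zero]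

theorem exists_isFormOn_of_mem_span_pow {x : ι → R} {s : Set ι} {n : ℕ} {h : R}
    (hh : h ∈ Ideal.span (x '' s) ^ n) : ∃ F, IsFormOn s n F ∧ eval x F = h := by
  rw [Set.image_eq_range, Ideal.mem_span_pow_iff_exists_isHomogeneous] at hh
  obtain ⟨p, hp, hev⟩ := hh
  refine ⟨rename (↑) p, ⟨hp.rename_isHomogeneous, fun m hm i hi => ?_⟩, ?_⟩
  · obtain ⟨u, rfl, -⟩ := coeff_rename_ne_zero _ _ _ hm
    exact Finsupp.mapDomain_of_notMem_range _ _ (by simpa using hi)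
  · rw [eval_rename]; exact hev

theorem exists_isFormOn_of_mem_mul_span_pow {x : ι → R} {s : Set ι} {𝔞 : Ideal R} {n : ℕ} {h : R}
    (hh : h ∈ 𝔞 * Ideal.span (x '' s) ^ n) :
    ∃ F, IsFormOn s n F ∧ (∀ m, coeff m F ∈ 𝔞) ∧ eval x F = h := by
  induction hh using Submodule.mul_induction_on' with
  | mem_mul_mem a ha b hb =>
    obtain ⟨F, hF, rfl⟩ := exists_isFormOn_of_mem_span_pow hb
    refine ⟨C a * F, hF.C_mul a, fun m => ?_, by simp⟩
    rw [coeff_C_mul]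
    exact 𝔞.mul_mem_right _ ha
  | add y _ z _ hy hz =>
    obtain ⟨F, hF, hFa, rfl⟩ := hy
    obtain ⟨G, hG, hGa, rfl⟩ := hz
    exact ⟨F + G, hF.add hG, fun m => by rw [coeff_add]; exact 𝔞.add_mem (hFa m) (hGa m), by simp⟩

theorem eval_mem_mul_span_pow_on {x : ι → R} {s : Set ι} {𝔞 : Ideal R} {n : ℕ}
    {F : MvPolynomial ι R} (hF : IsFormOn s n F) (hc : ∀ m, coeff m F ∈ 𝔞) :
    eval x F ∈ 𝔞 * Ideal.span (x '' s) ^ n := by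
  rw [eval_eq]
  refine Ideal.sum_mem _ fun m hm => Ideal.mul_mem_mul (hc m) ?_
  have hdeg : ∑ i ∈ m.support, m i = n := degree_eq_of_isHomogeneous hF.1 (mem_support_iff.1 hm)
  rw [← hdeg, ← Finset.prod_pow_eq_pow_sum]
  refine Ideal.prod_mem_prod fun i hi => Ideal.pow_mem_pow (Ideal.subset_span (Set.mem_image_of_mem x ?_)) _
  by_contra his
  exact Finsupp.mem_support_iff.1 hi (hF.2 m (mem_support_iff.1 hm) i his)

theorem IsFormOn.eval_mem {x : ι → R} {s : Set ι} {n : ℕ} {F : MvPolynomial ι R}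
    (hF : IsFormOn s n F) : eval x F ∈ Ideal.span (x '' s) ^ n := by
  have := eval_mem_mul_span_pow_on (x := x) (𝔞 := ⊤) hF fun _ => trivial
  rwa [Ideal.top_mul] at this

theorem IsFormOn.of_isHomogeneous {n : ℕ} {F : MvPolynomial ι R} (hF : F.IsHomogeneous n) :
    IsFormOn Set.univ n F := ⟨hF, fun _ _ i hi => absurd (Set.mem_univ i) hi⟩

theorem eval_mem_mul_span_pow {x : ι → R} {𝔞 : Ideal R} {n : ℕ} {F : MvPolynomial ι R}
    (hF : F.IsHomogeneous n) (hc : ∀ m, coeff m F ∈ 𝔞) :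
    eval x F ∈ 𝔞 * Ideal.span (Set.range x) ^ n := by
  simpa only [Set.image_univ] using eval_mem_mul_span_pow_on (x := x) (.of_isHomogeneous hF) hc

theorem eval_mem_span_pow {x : ι → R} {n : ℕ} {F : MvPolynomial ι R}
    (hF : F.IsHomogeneous n) : eval x F ∈ Ideal.span (Set.range x) ^ n := by
  simpa only [Set.image_univ] using IsFormOn.eval_mem (x := x) (.of_isHomogeneous hF)

/-- Quasi-regularity needs to be tested only on forms that vanish exactly: a value in the next power
can be cancelled by a form of the same degree with coefficients in the ideal. -/
theorem coeff_mem_of_vanishing {x : ι → R} {s : Set ι} {n : ℕ}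
    (h0 : ∀ F, IsFormOn s n F → eval x F = 0 → ∀ m, coeff m F ∈ Ideal.span (x '' s))
    {F : MvPolynomial ι R} (hF : IsFormOn s n F)
    (hev : eval x F ∈ Ideal.span (x '' s) ^ (n + 1)) (m : ι →₀ ℕ) :
    coeff m F ∈ Ideal.span (x '' s) := by
  rw [pow_succ'] at hev
  obtain ⟨F', hF', hc, hev'⟩ := exists_isFormOn_of_mem_mul_span_pow hev
  have := h0 (F + C (-1) * F') (hF.add (hF'.C_mul _)) (by simp [hev']) m
  rw [coeff_add, coeff_C_mul] at this
  exact (Ideal.add_mem_iff_left _ (Ideal.mul_mem_left _ _ (hc m))).1 this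

theorem exists_isHomogeneous_of_mem_mul_span_pow {x : ι → R} {𝔞 : Ideal R} {n : ℕ} {h : R}
    (hh : h ∈ 𝔞 * Ideal.span (Set.range x) ^ n) :
    ∃ F : MvPolynomial ι R, F.IsHomogeneous n ∧ (∀ m, coeff m F ∈ 𝔞) ∧ eval x F = h := by
  rw [← Set.image_univ] at hh
  obtain ⟨F, hF, hFa, hev⟩ := exists_isFormOn_of_mem_mul_span_pow hh
  exact ⟨F, hF.1, hFa, hev⟩

theorem exists_isHomogeneous_of_mem_span_pow {x : ι → R} {n : ℕ} {h : R}
    (hh : h ∈ Ideal.span (Set.range x) ^ n) :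
    ∃ F : MvPolynomial ι R, F.IsHomogeneous n ∧ eval x F = h := by
  rwa [Ideal.mem_span_pow_iff_exists_isHomogeneous] at hh

/-- Quasi-regularity of the family `x i`, `i ∈ s`. -/
def IsQuasiRegularOn (x : ι → R) (s : Set ι) : Prop :=
  ∀ n F, IsFormOn s n F → eval x F ∈ Ideal.span (x '' s) ^ (n + 1) →
    ∀ m, coeff m F ∈ Ideal.span (x '' s)

theorem eval_of_isHomogeneous_zero (x : ι → R) {F : MvPolynomial ι R} (hF : F.IsHomogeneous 0) :
    F = C (eval x F) := by
  have h := totalDegree_eq_zero_iff_eq_C.1 ((totalDegree_zero_iff_isHomogeneous ι).2 hF)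
  conv_rhs => rw [h]
  rw [eval_C, ← h]

theorem isQuasiRegularOn_empty (x : ι → R) : IsQuasiRegularOn x ∅ := by
  intro n F hF hev m
  rw [Set.image_empty, Ideal.span_empty, ← Ideal.zero_eq_bot, zero_pow (Nat.succ_ne_zero n)] at hev
  by_contra hm
  have hm' : coeff m F ≠ 0 := fun h => hm (by rw [h]; exact Ideal.zero_mem _)
  have hm0 : m = 0 := Finsupp.ext fun i => hF.2 m hm' i (by simp)
  subst hm0
  have hn : n = 0 := by simpa using (hF.1 hm').symm
  subst hn
  have := eval_of_isHomogeneous_zero x hF.1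
  rw [show eval x F = 0 from hev, C_0] at this
  simp [this] at hm'

/-- The associated graded ring of a quasi-regular ideal is a polynomial ring over the quotient, so a
nonzerodivisor modulo the ideal stays one modulo its powers. -/
theorem IsQuasiRegularOn.mem_span_pow {x : ι → R} {s : Set ι} (hs : IsQuasiRegularOn x s) {a : R}
    (ha : ∀ r, a * r ∈ Ideal.span (x '' s) → r ∈ Ideal.span (x '' s)) (n : ℕ) {r : R}
    (hr : a * r ∈ Ideal.span (x '' s) ^ n) : r ∈ Ideal.span (x '' s) ^ n := by
  induction n with
  | zero => simp
  | succ n ih =>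
    obtain ⟨Y, hY, rfl⟩ := exists_isFormOn_of_mem_span_pow
      (ih (Ideal.pow_le_pow_right (Nat.le_succ n) hr))
    have hc := hs n (C a * Y) (hY.C_mul a) (by simpa using hr)
    have := eval_mem_mul_span_pow_on (x := x) hY fun m => ha _ (by simpa using hc m)
    rwa [pow_succ']

theorem IsQuasiRegularOn.insert {x : ι → R} {s : Set ι} (hs : IsQuasiRegularOn x s) {i : ι}
    (hi : i ∉ s) (ha : ∀ r, x i * r ∈ Ideal.span (x '' s) → r ∈ Ideal.span (x '' s)) :
    IsQuasiRegularOn x (insert i s) := by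
  classical
  have hsub : Ideal.span (x '' s) ≤ Ideal.span (x '' Insert.insert i s) :=
    Ideal.span_mono (Set.image_mono (Set.subset_insert i s))
  have hxi : x i ∈ Ideal.span (x '' Insert.insert i s) :=
    Ideal.subset_span ⟨i, Set.mem_insert i s, rfl⟩
  -- it suffices to treat the forms which vanish at `x`
  suffices hzero : ∀ n F, IsFormOn (Insert.insert i s) n F → eval x F = 0 →
      ∀ m, coeff m F ∈ Ideal.span (x '' Insert.insert i s) by
    intro n F hF hev m
    exact coeff_mem_of_vanishing (hzero n) hF hev m
  intro n
  induction n with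
  | zero =>
    intro F hF hev m
    rw [eval_of_isHomogeneous_zero x hF.1, hev, C_0, coeff_zero]
    exact Ideal.zero_mem _
  | succ n ih =>
    intro F hF hev
    -- Write F = X_i H + G with G free of X_i. From x_i H(x) = -G(x) the value H(x) lies in the
    -- power n + 1 of the smaller ideal, so induction on the degree handles H, and quasi-regularity
    -- of the smaller family handles G + x_i h.
    set H := F.divMonomial (Finsupp.single i 1) with hH
    set G := F.modMonomial (Finsupp.single i 1) with hG
    have hFGH : X i * H + G = F := divMonomial_add_modMonomial_single F i
    have hHform : IsFormOn (Insert.insert i s) n H := by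
      refine ⟨fun m hm => ?_, fun m hm j hj => ?_⟩
      · rw [hH, coeff_divMonomial] at hm
        have := degree_eq_of_isHomogeneous hF.1 hm
        rw [weight_one_eq_degree]
        rw [map_add, Finsupp.degree_single] at this
        omega
      · rw [hH, coeff_divMonomial] at hm
        have := hF.2 _ hm j hj
        simp only [Finsupp.add_apply] at this
        omega
    have hGform : IsFormOn s (n + 1) G := by
      have hco : ∀ m, coeff m G ≠ 0 → ¬ Finsupp.single i 1 ≤ m ∧ coeff m F ≠ 0 := by
        intro m hm
        by_cases h : Finsupp.single i 1 ≤ m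
        · exact absurd (coeff_modMonomial_of_le F h) hm
        · exact ⟨h, by rwa [hG, coeff_modMonomial_of_not_le F h] at hm⟩
      refine ⟨fun m hm => hF.1 (hco m hm).2, fun m hm j hj => ?_⟩
      obtain ⟨h1, h2⟩ := hco m hm
      rcases eq_or_ne j i with rfl | hji
      · rw [Finsupp.single_le_iff] at h1; omega
      · exact hF.2 m h2 j (by simp [hji, hj])
    have hval : x i * eval x H + eval x G = 0 := by
      rw [← hev, ← hFGH]; simp
    have hHmem : eval x H ∈ Ideal.span (x '' s) ^ (n + 1) := by
      refine hs.mem_span_pow ha _ ?_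
      rw [eq_neg_of_add_eq_zero_left hval]
      exact neg_mem (hGform.eval_mem)
    have hHc := coeff_mem_of_vanishing ih hHform (Ideal.pow_right_mono hsub _ hHmem)
    obtain ⟨h, hh, hhev⟩ := exists_isFormOn_of_mem_span_pow hHmem
    have hGc := hs (n + 1) (G + C (x i) * h) (hGform.add (hh.C_mul _)) (by
      rw [map_add, map_mul, eval_C, hhev, add_comm (eval x G), hval]; exact Ideal.zero_mem _)
    intro m
    rw [← hFGH, coeff_add]
    refine Ideal.add_mem _ ?_ ?_
    · rw [mul_comm, coeff_mul_X']
      split_ifs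
      · exact hHc _
      · exact Ideal.zero_mem _
    · have := hsub (hGc m)
      rw [coeff_add, coeff_C_mul] at this
      exact (Ideal.add_mem_iff_left _ (Ideal.mul_mem_right _ _ hxi)).1 this

theorem isQuasiRegularOn_univ_of_regular {d : ℕ} (x : Fin d → R)
    (hx : ∀ i r, x i * r ∈ Ideal.span (x '' {j | j < i}) → r ∈ Ideal.span (x '' {j | j < i})) :
    IsQuasiRegularOn x Set.univ := by
  have key : ∀ k ≤ d, IsQuasiRegularOn x {j | j.val < k} := by
    intro k
    induction k with
    | zero => intro _; simpa using isQuasiRegularOn_empty x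
    | succ k ih =>
      intro hk
      have h1 : {j : Fin d | j.val < k + 1} = insert ⟨k, hk⟩ {j | j.val < k} := by
        ext j
        simp only [Set.mem_ofPred_eq, Set.mem_insert_iff, Fin.ext_iff]
        omega
      rw [h1]
      exact (ih (by omega)).insert (by simp) (hx ⟨k, hk⟩)
  convert key d le_rfl
  ext j; simp

/-- Two forms with the same value have coefficients congruent modulo the ideal of the `x i`, and
that ideal lies in `𝔞`. -/
theorem coeff_mem_of_eval_mem_mul {x : ι → R} (hx : IsQuasiRegularOn x Set.univ)
    {𝔞 : Ideal R} (h𝔞 : Ideal.span (Set.range x) ≤ 𝔞) {n : ℕ} {F : MvPolynomial ι R} (hF : F.IsHomogeneous n)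
    (hev : eval x F ∈ 𝔞 * Ideal.span (Set.range x) ^ n) (m : ι →₀ ℕ) : coeff m F ∈ 𝔞 := by
  obtain ⟨G, hG, hGc, hGev⟩ := exists_isHomogeneous_of_mem_mul_span_pow hev
  have h := hx n (F - G) (.of_isHomogeneous (hF.sub hG)) (by simp [hGev]) m
  rw [Set.image_univ, coeff_sub] at h
  simpa using 𝔞.add_mem (h𝔞 h) (hGc m)

/-- The algebra map `R[T] → R[t]` sending `T i` to `x i * t`. -/
noncomputable def reesEval (x : ι → R) : MvPolynomial ι R →ₐ[R] Polynomial R :=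
  aeval fun i => Polynomial.C (x i) * Polynomial.X

theorem coeff_reesEval (x : ι → R) (f : MvPolynomial ι R) (n : ℕ) :
    (reesEval x f).coeff n = eval x (homogeneousComponent n f) := by
  induction f using MvPolynomial.induction_on' with
  | add p q hp hq => simp only [map_add, Polynomial.coeff_add, hp, hq]
  | monomial u a =>
    have h1 : reesEval x (monomial u a) = Polynomial.monomial u.degree (eval x (monomial u a)) := by
      rw [reesEval, aeval_monomial, eval_monomial]
      simp only [mul_pow, Finsupp.prod, Finset.prod_mul_distrib, ← map_pow, ← map_prod,
        Finset.prod_pow_eq_pow_sum]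
      rw [← mul_assoc, Polynomial.algebraMap_eq, ← map_mul, Polynomial.C_mul_X_pow_eq_monomial]
      rfl
    rw [h1, Polynomial.coeff_monomial,
      homogeneousComponent_of_mem ((mem_homogeneousSubmodule _ _).2 (isHomogeneous_monomial a rfl))]
    simp only [eq_comm (a := n)]
    split_ifs <;> simp

end Forms

/-! ### Forms with nonzero residue are nonzerodivisors. -/

section LocalForms

open MvPolynomial IsLocalRing

variable {ι R : Type*} [CommRing R] [IsLocalRing R]

/-- Multiply by elements of the maximal ideal for as long as the result stays outside `N`. This
reduces later cancellation arguments to products over the residue field. -/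
theorem exists_smul_socle {E : Type*} [AddCommGroup E] [Module R E] {N : Submodule R E} {y : E}
    (hy : y ∉ N) {k : ℕ} (hk : ∀ r ∈ maximalIdeal R ^ k, r • y ∈ N) :
    ∃ μ : R, μ • y ∉ N ∧ ∀ r ∈ maximalIdeal R, r • μ • y ∈ N := by
  induction k with
  | zero => exact absurd (by simpa using hk 1 (by simp)) hy
  | succ k ih =>
    by_cases h : ∀ r ∈ maximalIdeal R ^ k, r • y ∈ N
    · exact ih h
    · push Not at h
      obtain ⟨μ, hμ, hμy⟩ := h
      refine ⟨μ, hμy, fun r hr => ?_⟩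
      rw [← mul_smul]
      exact hk _ (by rw [pow_succ']; exact Ideal.mul_mem_mul hr hμ)

theorem map_residue_ne_zero_iff {f : MvPolynomial ι R} :
    MvPolynomial.map (residue R) f ≠ 0 ↔ ∃ m, coeff m f ∉ maximalIdeal R := by
  rw [MvPolynomial.ne_zero_iff]
  simp only [coeff_map, ne_eq, residue_eq_zero_iff]

theorem map_residue_eq_zero_iff {f : MvPolynomial ι R} :
    MvPolynomial.map (residue R) f = 0 ↔ ∀ m, coeff m f ∈ maximalIdeal R := by
  rw [← not_iff_not, ← ne_eq, map_residue_ne_zero_iff]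
  push Not; rfl

/-- After passing to a socle element, only the residues of the coefficients of `f` matter, and the
argument is the one showing that a polynomial ring over a field has no zero divisors. -/
theorem coeff_mem_of_coeff_mul_mem {𝔞 : Ideal R} {k : ℕ} (hk : maximalIdeal R ^ k ≤ 𝔞)
    {f Y : MvPolynomial ι R} (hf : MvPolynomial.map (residue R) f ≠ 0)
    (h : ∀ m, coeff m (f * Y) ∈ 𝔞) (m : ι →₀ ℕ) : coeff m Y ∈ 𝔞 := by
  classical
  let N : Submodule R (MvPolynomial ι R) :=
    { carrier := {Y | ∀ m, coeff m Y ∈ 𝔞}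
      zero_mem' := fun m => by simp
      add_mem' := fun hx hy m => by rw [coeff_add]; exact 𝔞.add_mem (hx m) (hy m)
      smul_mem' := fun a x hx m => by rw [coeff_smul]; exact 𝔞.mul_mem_left _ (hx m) }
  suffices hYN : Y ∈ N from hYN m
  by_contra hYN
  obtain ⟨μ, hμ, hμm⟩ := exists_smul_socle (k := k) hYN fun r hr m => by
    rw [coeff_smul]; exact 𝔞.mul_mem_right _ (hk hr)
  have hμh : ∀ m, coeff m (f * (μ • Y)) ∈ 𝔞 := fun m => by
    rw [mul_smul_comm, coeff_smul]; exact 𝔞.mul_mem_left _ (h m)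
  obtain ⟨a₁, ha₁⟩ := map_residue_ne_zero_iff.1 hf
  have : ∃ b₁, coeff b₁ (μ • Y) ∉ 𝔞 := by
    by_contra hcon
    push Not at hcon
    exact hμ hcon
  obtain ⟨b₁, hb₁⟩ := this
  have hA : (f.support.filter fun a => coeff a f ∉ maximalIdeal R).Nonempty :=
    ⟨a₁, by
      simp only [Finset.mem_filter, mem_support_iff]
      exact ⟨fun h0 => ha₁ (by rw [h0]; exact Ideal.zero_mem _), ha₁⟩⟩
  have hB : ((μ • Y).support.filter fun b => coeff b (μ • Y) ∉ 𝔞).Nonempty :=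
    ⟨b₁, by
      simp only [Finset.mem_filter, mem_support_iff]
      exact ⟨fun h0 => hb₁ (by rw [h0]; exact Ideal.zero_mem _), hb₁⟩⟩
  -- Exponent vectors have unique sums: some pair of surviving exponents `a`, `b` has a sum reached
  -- by no other surviving pair, so its product cannot cancel.
  obtain ⟨a, ha, b, hb, huniq⟩ := UniqueSums.uniqueAdd_of_nonempty hA hB
  have ha' := (Finset.mem_filter.1 ha).2
  have hb' := (Finset.mem_filter.1 hb).2
  have hsum := hμh (a + b)
  rw [coeff_mul, ← Finset.add_sum_erase _ _
    (Finset.HasAntidiagonal.mem_antidiagonal.2 (rfl : (a, b).1 + (a, b).2 = a + b))] at hsum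
  have hrest : ∑ p ∈ (Finset.HasAntidiagonal.antidiagonal (a + b)).erase (a, b),
      coeff p.1 f * coeff p.2 (μ • Y) ∈ 𝔞 := by
    refine 𝔞.sum_mem fun p hp => ?_
    obtain ⟨hne, hp⟩ := Finset.mem_erase.1 hp
    rw [Finset.HasAntidiagonal.mem_antidiagonal] at hp
    by_cases h1 : coeff p.1 f ∈ maximalIdeal R
    · have := hμm _ h1 p.2
      rwa [coeff_smul] at this
    by_cases h2 : coeff p.2 (μ • Y) ∈ 𝔞
    · exact 𝔞.mul_mem_left _ h2
    · refine absurd (Prod.ext_iff.2 (huniq (Finset.mem_filter.2 ⟨?_, h1⟩)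
        (Finset.mem_filter.2 ⟨?_, h2⟩) hp)) hne
      · exact mem_support_iff.2 fun h0 => h1 (by rw [h0]; exact Ideal.zero_mem _)
      · exact mem_support_iff.2 fun h0 => h2 (by rw [h0]; exact Ideal.zero_mem _)
  have hlead := (Ideal.add_mem_iff_left _ hrest).1 hsum
  have hu : IsUnit (coeff a f) := by simpa using ha'
  exact hb' ((Ideal.unit_mul_mem_iff_mem _ hu).1 hlead)

theorem mem_mul_span_pow_of_eval_mul_mem {x : ι → R} (hx : IsQuasiRegularOn x Set.univ) {k : ℕ}
    (hk : maximalIdeal R ^ k ≤ Ideal.span (Set.range x)) {𝔞 : Ideal R}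
    (h𝔞 : Ideal.span (Set.range x) ≤ 𝔞) {n l : ℕ} {f : MvPolynomial ι R}
    (hf : f.IsHomogeneous l) (hf0 : MvPolynomial.map (residue R) f ≠ 0) {h : R}
    (hfh : eval x f * h ∈ 𝔞 * Ideal.span (Set.range x) ^ (l + n)) :
    h ∈ 𝔞 * Ideal.span (Set.range x) ^ n := by
  have hpow : h ∈ Ideal.span (Set.range x) ^ n := by
    have hfh' := Ideal.mul_le_right hfh
    clear hfh
    induction n with
    | zero => simp
    | succ n ih =>
      obtain ⟨Y, hY, rfl⟩ := exists_isHomogeneous_of_mem_span_pow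
        (ih (Ideal.pow_le_pow_right (by omega) hfh'))
      have hc := hx (l + n) (f * Y) (.of_isHomogeneous (hf.mul hY))
        (by rwa [map_mul, Set.image_univ])
      rw [Set.image_univ] at hc
      have := eval_mem_mul_span_pow (x := x) hY (coeff_mem_of_coeff_mul_mem hk hf0 hc)
      rwa [pow_succ']
  obtain ⟨Y, hY, rfl⟩ := exists_isHomogeneous_of_mem_span_pow hpow
  rw [← map_mul] at hfh
  exact eval_mem_mul_span_pow hY (coeff_mem_of_coeff_mul_mem (hk.trans h𝔞) hf0
    (coeff_mem_of_eval_mem_mul hx h𝔞 (hf.mul hY) hfh))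

/-- Passage from homogeneous to arbitrary `f` and `h` by comparing top degrees. The filtration is
left abstract because it serves for K·J^n as well as for J^{n-i}. -/
theorem coeff_mem_of_coeff_reesEval_mul_mem {x : ι → R} {𝓕 : ℕ → Ideal R}
    (hmul : ∀ n l, 𝓕 n * Ideal.span (Set.range x) ^ l ≤ 𝓕 (l + n))
    (hreg : ∀ (n l : ℕ) (f : MvPolynomial ι R), f.IsHomogeneous l →
      MvPolynomial.map (residue R) f ≠ 0 → ∀ h, eval x f * h ∈ 𝓕 (l + n) → h ∈ 𝓕 n)
    (hprim : ∀ n, ∃ k, maximalIdeal R ^ k ≤ 𝓕 n) {f : MvPolynomial ι R}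
    (hf : MvPolynomial.map (residue R) f ≠ 0) {h : Polynomial R}
    (hfh : ∀ n, (reesEval x f * h).coeff n ∈ 𝓕 n) (n : ℕ) : h.coeff n ∈ 𝓕 n := by
  classical
  let N : Submodule R (Polynomial R) :=
    { carrier := {Y | ∀ m, Y.coeff m ∈ 𝓕 m}
      zero_mem' := fun m => by simp
      add_mem' := fun hx hy m => by rw [Polynomial.coeff_add]; exact (𝓕 m).add_mem (hx m) (hy m)
      smul_mem' := fun a x hx m => by
        rw [Polynomial.coeff_smul]; exact (𝓕 m).mul_mem_left _ (hx m) }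
  suffices hN : h ∈ N from hN n
  by_contra hhN
  choose k hk using hprim
  obtain ⟨μ, hμ, hμm⟩ := exists_smul_socle (k := ∑ m ∈ h.support, k m) hhN fun r hr m => by
    rw [Polynomial.coeff_smul]
    by_cases hm : m ∈ h.support
    · exact (𝓕 m).mul_mem_right _ (hk m (Ideal.pow_le_pow_right
        (Finset.single_le_sum (fun _ _ => Nat.zero_le _) hm) hr))
    · rw [Polynomial.notMem_support_iff.1 hm, smul_zero]; exact (𝓕 m).zero_mem
  have hμh : ∀ n, (reesEval x f * (μ • h)).coeff n ∈ 𝓕 n := fun n => by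
    rw [mul_smul_comm, Polynomial.coeff_smul]; exact (𝓕 n).mul_mem_left _ (hfh n)
  generalize μ • h = g at hμ hμm hμh
  have hex : ∃ n, g.coeff n ∉ 𝓕 n := by
    by_contra hcon
    push Not at hcon
    exact hμ hcon
  obtain ⟨n, hn, hnmax⟩ : ∃ n, g.coeff n ∉ 𝓕 n ∧ ∀ j, n < j → g.coeff j ∈ 𝓕 j := by
    have hfin : (g.support.filter fun n => g.coeff n ∉ 𝓕 n).Nonempty := by
      obtain ⟨n, hn⟩ := hex
      refine ⟨n, Finset.mem_filter.2 ⟨Polynomial.mem_support_iff.2 fun h0 => hn ?_, hn⟩⟩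
      rw [h0]; exact Ideal.zero_mem _
    refine ⟨_, (Finset.mem_filter.1 (Finset.max'_mem _ hfin)).2, fun j hj => ?_⟩
    by_contra hcon
    refine absurd (Finset.le_max' _ j (Finset.mem_filter.2
      ⟨Polynomial.mem_support_iff.2 fun h0 => hcon ?_, hcon⟩)) (not_le.2 hj)
    rw [h0]; exact Ideal.zero_mem _
  obtain ⟨l, hl, hlmax⟩ : ∃ l, MvPolynomial.map (residue R) (homogeneousComponent l f) ≠ 0 ∧
      ∀ i, l < i → MvPolynomial.map (residue R) (homogeneousComponent i f) = 0 := by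
    have hzero : ∀ i, f.totalDegree < i → homogeneousComponent i f = 0 :=
      fun i hi => homogeneousComponent_eq_zero _ _ hi
    have hfin : ((Finset.range (f.totalDegree + 1)).filter fun i =>
        MvPolynomial.map (residue R) (homogeneousComponent i f) ≠ 0).Nonempty := by
      by_contra hcon
      rw [Finset.not_nonempty_iff_eq_empty, Finset.filter_eq_empty_iff] at hcon
      apply hf
      rw [← sum_homogeneousComponent f, map_sum]
      exact Finset.sum_eq_zero fun i hi => by simpa using hcon hi
    refine ⟨_, (Finset.mem_filter.1 (Finset.max'_mem _ hfin)).2, fun j hj => ?_⟩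
    by_contra hcon
    refine absurd (Finset.le_max' _ j (Finset.mem_filter.2 ⟨?_, hcon⟩)) (not_le.2 hj)
    rw [Finset.mem_range]
    by_contra hlt
    exact hcon (by rw [hzero j (by omega), map_zero])
  -- `n` is the top degree of `g` modulo the filtration and `l` that of `f` modulo the maximal
  -- ideal. Below `n` the residue of `f` vanishes and the socle property of `g` applies; above `n`
  -- the coefficient of `g` is already in the filtration.
  have hsum := hμh (l + n)
  rw [Polynomial.coeff_mul, ← Finset.add_sum_erase _ _
    (Finset.HasAntidiagonal.mem_antidiagonal.2 (rfl : (l, n).1 + (l, n).2 = l + n))] at hsum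
  have hrest : ∑ p ∈ (Finset.HasAntidiagonal.antidiagonal (l + n)).erase (l, n),
      (reesEval x f).coeff p.1 * g.coeff p.2 ∈ 𝓕 (l + n) := by
    refine (𝓕 _).sum_mem fun p hp => ?_
    obtain ⟨hne, hp⟩ := Finset.mem_erase.1 hp
    rw [Finset.HasAntidiagonal.mem_antidiagonal] at hp
    rw [coeff_reesEval, ← hp]
    rcases lt_trichotomy p.2 n with hlt | heq | hgt
    · have h1 := hlmax p.1 (by omega)
      rw [map_residue_eq_zero_iff] at h1
      have h2 := eval_mem_mul_span_pow (x := x)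
        (homogeneousComponent_isHomogeneous p.1 f) h1
      refine hmul p.2 p.1 ?_
      have h3 : maximalIdeal R * Ideal.span {g.coeff p.2} ≤ 𝓕 p.2 := by
        rw [mul_comm, Ideal.span_singleton_mul_le_iff]
        intro r hr
        have := hμm r hr p.2
        rwa [Polynomial.coeff_smul, smul_eq_mul, mul_comm] at this
      have h4 := Ideal.mul_mem_mul h2 (Ideal.mem_span_singleton_self (g.coeff p.2))
      rw [mul_right_comm] at h4
      exact Ideal.mul_mono_left h3 h4
    · exact absurd (Prod.ext (by simp; omega) heq) hne
    · have h2 := eval_mem_span_pow (x := x) (homogeneousComponent_isHomogeneous p.1 f)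
      refine hmul p.2 p.1 ?_
      exact mul_comm (g.coeff p.2) _ ▸ Ideal.mul_mem_mul (hnmax _ hgt) h2
  have hlead := (Ideal.add_mem_iff_left _ hrest).1 hsum
  rw [coeff_reesEval] at hlead
  exact hn (hreg n l _ (homogeneousComponent_isHomogeneous l f) hl _ hlead)

end LocalForms

/-! ### The Rees module of K over the polynomial ring and its cyclic filtration. -/

section AlmostMinimal

open MvPolynomial IsLocalRing

variable {R : Type*} [CommRing R]

/-- The submodule of `R[t]` of the polynomials whose `n`-th coefficient lies in `𝓕 n`. -/
noncomputable def coeffSubmodule {ι : Type*} (x : ι → R) (𝓕 : ℕ → Ideal R)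
    (hmul : ∀ n l, 𝓕 n * Ideal.span (Set.range x) ^ l ≤ 𝓕 (l + n)) :
    letI := (reesEval x).toAlgebra
    Submodule (MvPolynomial ι R) (Polynomial R) :=
  letI := (reesEval x).toAlgebra
  { carrier := {h | ∀ n, h.coeff n ∈ 𝓕 n}
    zero_mem' := fun n => by simp
    add_mem' := fun hx hy n => by rw [Polynomial.coeff_add]; exact (𝓕 n).add_mem (hx n) (hy n)
    smul_mem' := fun f h hh n => by
      change (reesEval x f * h).coeff n ∈ _
      rw [Polynomial.coeff_mul]
      refine Ideal.sum_mem _ fun p hp => ?_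
      rw [Finset.HasAntidiagonal.mem_antidiagonal] at hp
      rw [coeff_reesEval, ← hp]
      exact hmul p.2 p.1 (mul_comm (h.coeff p.2) _ ▸ Ideal.mul_mem_mul (hh p.2)
        (eval_mem_span_pow (homogeneousComponent_isHomogeneous p.1 f))) }

theorem reesEval_of_isHomogeneous {ι : Type*} (x : ι → R) {n : ℕ} {F : MvPolynomial ι R}
    (hF : F.IsHomogeneous n) : reesEval x F = Polynomial.monomial n (eval x F) := by
  ext m
  rw [coeff_reesEval, Polynomial.coeff_monomial,
    homogeneousComponent_of_mem ((mem_homogeneousSubmodule _ _).2 hF)]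
  simp only [eq_comm (a := m)]
  split_ifs <;> simp

section Ideals

variable {I K J : Ideal R} {a b : R}

theorem mul_pow_succ_eq_sup (ha : a ∈ K) (hb : b ∈ I)
    (hgen : K * I = K * J ⊔ Ideal.span {a * b}) (i : ℕ) :
    K * I ^ (i + 1) = K * J * I ^ i ⊔ Ideal.span {a * b ^ (i + 1)} := by
  induction i with
  | zero => simpa using hgen
  | succ i ih =>
    apply le_antisymm
    · rw [pow_succ, ← mul_assoc, ih, Ideal.sup_mul, mul_assoc (K * J), ← pow_succ]
      refine sup_le le_sup_left ?_
      rw [Ideal.span_singleton_mul_le_iff]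
      intro y hy
      have h1 : a * y ∈ K * J ⊔ Ideal.span {a * b} := hgen ▸ Ideal.mul_mem_mul ha hy
      obtain ⟨u, hu, v, hv, huv⟩ := Submodule.mem_sup.1 h1
      obtain ⟨c, rfl⟩ := Ideal.mem_span_singleton'.1 hv
      have h2 : a * b ^ (i + 1) * y = u * b ^ (i + 1) + c * (a * b ^ (i + 1 + 1)) := by
        rw [mul_right_comm, ← huv]; ring
      rw [h2]
      exact Submodule.add_mem_sup (Ideal.mul_mem_mul hu (Ideal.pow_mem_pow hb _))
        (Ideal.mul_mem_left _ _ (Ideal.mem_span_singleton_self _))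
    · refine sup_le ?_ ?_
      · rw [pow_succ' I (i + 1), ← mul_assoc]
        exact Ideal.mul_mono (hgen ▸ le_sup_left) le_rfl
      · rw [Ideal.span_singleton_le_iff_mem]
        exact Ideal.mul_mem_mul ha (Ideal.pow_mem_pow hb _)

theorem mul_pow_succ_mul_pow_eq_sup (ha : a ∈ K) (hb : b ∈ I)
    (hgen : K * I = K * J ⊔ Ideal.span {a * b}) (i m : ℕ) :
    K * I ^ (i + 1) * J ^ m = K * I ^ i * J ^ (m + 1) ⊔ Ideal.span {a * b ^ (i + 1)} * J ^ m := by
  rw [mul_pow_succ_eq_sup ha hb hgen, Ideal.sup_mul]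
  congr 1
  ring

end Ideals

section CyclicFiltrationRees

variable {d : ℕ} {x : Fin d → R} {I K : Ideal R} {a b : R}

theorem mul_pow_mul_span_pow_le (K J : Ideal R) (n l : ℕ) : K * J ^ n * J ^ l ≤ K * J ^ (l + n) := by
  rw [mul_assoc, ← pow_add, add_comm]

/-- The Rees module `⨁ K J ^ n t ^ n` inside `R[t]`. -/
noncomputable abbrev reesSubmodule (x : Fin d → R) (K : Ideal R) :
    letI := (reesEval x).toAlgebra
    Submodule (MvPolynomial (Fin d) R) (Polynomial R) :=
  coeffSubmodule x (fun n => K * Ideal.span (Set.range x) ^ n)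
    (fun n l => mul_pow_mul_span_pow_le K _ n l)

noncomputable abbrev reesFiltration (x : Fin d → R) (K : Ideal R) (a b : R) (i : ℕ) :
    letI := (reesEval x).toAlgebra
    Submodule (MvPolynomial (Fin d) R) (Polynomial R) :=
  letI := (reesEval x).toAlgebra
  cyclicFiltration (reesSubmodule x K) (Polynomial.monomial 1 b) (Polynomial.monomial 1 (a * b)) i

theorem monomial_pow_mul (a b : R) (i : ℕ) :
    (Polynomial.monomial 1 b) ^ i * Polynomial.monomial 1 (a * b) =
      Polynomial.monomial (i + 1) (a * b ^ (i + 1)) := by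
  rw [Polynomial.monomial_pow, Polynomial.monomial_mul_monomial]
  congr 1
  · rw [one_mul]
  · ring

/-- Together with `coeff_mem_of_mem_reesFiltration` this identifies the part of degree i + m of step
i with K·I^i·J^m. -/
theorem monomial_mem_reesFiltration (ha : a ∈ K) (hb : b ∈ I)
    (hgen : K * I = K * Ideal.span (Set.range x) ⊔ Ideal.span {a * b}) (i m : ℕ) {h : R}
    (hh : h ∈ K * I ^ i * Ideal.span (Set.range x) ^ m) :
    Polynomial.monomial (i + m) h ∈ reesFiltration x K a b i := by
  let _ := (reesEval x).toAlgebra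
  induction i generalizing m h with
  | zero =>
    intro n
    rw [Polynomial.coeff_monomial]
    split_ifs with hn
    · subst hn; simpa using hh
    · exact Ideal.zero_mem _
  | succ i ih =>
    rw [mul_pow_succ_mul_pow_eq_sup ha hb hgen] at hh
    obtain ⟨u, hu, v, hv, rfl⟩ := Submodule.mem_sup.1 hh
    obtain ⟨w, hw, rfl⟩ := Ideal.mem_span_singleton_mul.1 hv
    obtain ⟨F, hF, rfl⟩ := exists_isHomogeneous_of_mem_span_pow hw
    refine mem_cyclicFiltration_succ.2 ⟨F, ?_⟩
    have h1 : F • ((Polynomial.monomial 1 b) ^ i * Polynomial.monomial 1 (a * b)) =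
        Polynomial.monomial (i + 1 + m) (a * b ^ (i + 1) * eval x F) := by
      rw [monomial_pow_mul]
      change reesEval x F * _ = _
      rw [reesEval_of_isHomogeneous x hF, Polynomial.monomial_mul_monomial, add_comm, mul_comm]
    rw [h1, map_add, add_sub_cancel_right]
    have := ih (m + 1) hu
    rwa [show i + 1 + m = i + (m + 1) by ring]

theorem coeff_mem_of_mem_reesFiltration (ha : a ∈ K) (hb : b ∈ I)
    (hJI : Ideal.span (Set.range x) ≤ I) (i m : ℕ) {h : Polynomial R}
    (hh : h ∈ reesFiltration x K a b i) :
    h.coeff (i + m) ∈ K * I ^ i * Ideal.span (Set.range x) ^ m := by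
  let _ := (reesEval x).toAlgebra
  induction i generalizing m h with
  | zero => simpa using hh m
  | succ i ih =>
    obtain ⟨F, hF⟩ := mem_cyclicFiltration_succ.1 hh
    have h1 := ih (m + 1) hF
    have h2 : (F • ((Polynomial.monomial 1 b) ^ i * Polynomial.monomial 1 (a * b))).coeff
        (i + 1 + m) = eval x (homogeneousComponent m F) * (a * b ^ (i + 1)) := by
      rw [monomial_pow_mul]
      change (reesEval x F * _).coeff _ = _
      rw [add_comm (i + 1) m, Polynomial.coeff_mul_monomial, coeff_reesEval]
    rw [Polynomial.coeff_sub, show i + (m + 1) = i + 1 + m by ring, h2] at h1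
    have h3 : eval x (homogeneousComponent m F) * (a * b ^ (i + 1)) ∈
        K * I ^ (i + 1) * Ideal.span (Set.range x) ^ m := by
      rw [mul_comm (eval x _)]
      exact Ideal.mul_mem_mul (Ideal.mul_mem_mul ha (Ideal.pow_mem_pow hb _))
        (eval_mem_span_pow (homogeneousComponent_isHomogeneous m F))
    have h4 : K * I ^ i * Ideal.span (Set.range x) ^ (m + 1) ≤
        K * I ^ (i + 1) * Ideal.span (Set.range x) ^ m := by
      rw [pow_succ', pow_succ, ← mul_assoc, ← mul_assoc]
      exact Ideal.mul_mono (Ideal.mul_mono le_rfl hJI) le_rfl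
    simpa using Ideal.add_mem _ (h4 h1) h3

/-- The saturation stays inside ⨁ J^{n-i} t^n, with J^{n-i} = R for n ≤ i, because forms with
nonzero residue are nonzerodivisors for this filtration too. That module is generated by 1, t, …,
t^i. -/
theorem isNoetherian_saturation_reesFiltration [IsLocalRing R] [IsNoetherianRing R]
    (hx : IsQuasiRegularOn x Set.univ) {k : ℕ}
    (hk : maximalIdeal R ^ k ≤ Ideal.span (Set.range x)) (i : ℕ) :
    letI := (reesEval x).toAlgebra
    IsNoetherian (MvPolynomial (Fin d) R)
      (saturation (MvPolynomial.map (residue R)) (reesFiltration x K a b i)) := by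
  let _ := (reesEval x).toAlgebra
  set J := Ideal.span (Set.range x) with hJ
  have hmul : ∀ n l, J ^ (n - i) * J ^ l ≤ J ^ (l + n - i) := fun n l => by
    rw [← pow_add]
    exact Ideal.pow_le_pow_right (by omega)
  have hprim : ∀ n, ∃ k, maximalIdeal R ^ k ≤ J ^ (n - i) :=
    fun n => ⟨k * (n - i), by rw [pow_mul]; exact Ideal.pow_right_mono hk _⟩
  let E := coeffSubmodule x (fun n => J ^ (n - i)) hmul
  have hNE : reesFiltration x K a b i ≤ E := by
    suffices ∀ j ≤ i, reesFiltration x K a b j ≤ E from this i le_rfl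
    intro j
    induction j with
    | zero =>
      intro _ h hh n
      have h1 : h.coeff n ∈ K * J ^ n := hh n
      have h2 : K * J ^ n ≤ J ^ (n - i) :=
        Ideal.mul_le_right.trans (Ideal.pow_le_pow_right (Nat.sub_le n i))
      exact h2 h1
    | succ j ih =>
      intro hj
      refine sup_le (ih (by omega)) ?_
      rw [Submodule.span_singleton_le_iff_mem, monomial_pow_mul]
      intro n
      rw [Polynomial.coeff_monomial]
      split_ifs with hn
      · subst hn
        change _ ∈ J ^ (j + 1 - i)
        rw [Nat.sub_eq_zero_of_le hj]; simp
      · exact Ideal.zero_mem _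
  have hE : E ≤ Submodule.span (MvPolynomial (Fin d) R)
      ((fun n => Polynomial.X ^ n) '' (Finset.range (i + 1) : Set ℕ)) := by
    intro h hh
    rw [← Polynomial.sum_monomial_eq h]
    refine Submodule.sum_mem _ fun n _ => ?_
    obtain ⟨F, hF, hev⟩ := exists_isHomogeneous_of_mem_span_pow (hh n)
    have h1 : Polynomial.monomial n (h.coeff n) = F • (Polynomial.X ^ (min n i) : Polynomial R) := by
      change _ = reesEval x F * _
      rw [reesEval_of_isHomogeneous x hF, hev, ← Polynomial.monomial_one_right_eq_X_pow,
        Polynomial.monomial_mul_monomial, mul_one]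
      rw [show n - i + min n i = n by omega]
    change Polynomial.monomial n (h.coeff n) ∈ _
    rw [h1]
    exact Submodule.smul_mem _ _ (Submodule.subset_span ⟨min n i, by simp, rfl⟩)
  have hsat : saturation (MvPolynomial.map (residue R)) (reesFiltration x K a b i) ≤ E := by
    rintro h ⟨f, hf, hfh⟩ n
    refine coeff_mem_of_coeff_reesEval_mul_mem hmul ?_ hprim hf (hNE hfh) n
    intro n l f hfl hf0 h hh
    rcases le_total n i with hni | hni
    · rw [Nat.sub_eq_zero_of_le hni]; simp
    · have := mem_mul_span_pow_of_eval_mul_mem hx hk (𝔞 := ⊤) le_top hfl hf0 (n := n - i) (h := h)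
      rw [Ideal.top_mul, Ideal.top_mul] at this
      refine this ?_
      rwa [← Nat.add_sub_assoc hni]
  have : IsNoetherian (MvPolynomial (Fin d) R) (Submodule.span (MvPolynomial (Fin d) R)
      ((fun n => (Polynomial.X ^ n : Polynomial R)) '' (Finset.range (i + 1) : Set ℕ))) :=
    isNoetherian_span_of_finite _ ((Finset.finite_toSet _).image _)
  exact isNoetherian_of_le (hsat.trans hE)

/-- The abstract result is applied with B = R[T], D = k[T], M = R[t] and the elements bt and abt. It
gives freeness of the cyclic quotients of index below `s`, and the claim is read off in one degree.
-/
theorem map_residue_eq_zero_of_mul_mem [IsLocalRing R] [IsNoetherianRing R]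
    (hx : IsQuasiRegularOn x Set.univ) {k : ℕ}
    (hk : maximalIdeal R ^ k ≤ Ideal.span (Set.range x)) (hJK : Ideal.span (Set.range x) ≤ K)
    (hJI : Ideal.span (Set.range x) ≤ I) (ha : a ∈ K) (hb : b ∈ I)
    (hgen : K * I = K * Ideal.span (Set.range x) ⊔ Ideal.span {a * b})
    (hsoc : ∀ r ∈ maximalIdeal R, r * (a * b) ∈ K * Ideal.span (Set.range x)) {s : ℕ}
    (hs : ∀ j < s, a * b ^ (j + 1) ∉ K * I ^ j * Ideal.span (Set.range x)) {j : ℕ} (hj : j < s)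
    {m : ℕ} {F : MvPolynomial (Fin d) R} (hF : F.IsHomogeneous m)
    (hmem : eval x F * (a * b ^ (j + 1)) ∈ K * I ^ j * Ideal.span (Set.range x) ^ (m + 1)) :
    MvPolynomial.map (residue R) F = 0 := by
  let _ := (reesEval x).toAlgebra
  set J := Ideal.span (Set.range x) with hJ
  have hprim : ∀ n, ∃ l, maximalIdeal R ^ l ≤ K * J ^ n :=
    fun n => ⟨k * (n + 1), by
      rw [pow_mul]
      exact (Ideal.pow_right_mono hk _).trans (by rw [pow_succ']; exact Ideal.mul_mono_left hJK)⟩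
  have hN : ∀ (f : MvPolynomial (Fin d) R) (h : Polynomial R), MvPolynomial.map (residue R) f ≠ 0 →
      f • h ∈ reesSubmodule x K → h ∈ reesSubmodule x K := by
    intro f h hf hfh
    exact coeff_mem_of_coeff_reesEval_mul_mem (fun n l => mul_pow_mul_span_pow_le K _ n l)
      (fun n l f hfl hf0 h hh => mem_mul_span_pow_of_eval_mul_mem hx hk hJK hfl hf0 hh)
      hprim hf hfh
  have hker : ∀ f : MvPolynomial (Fin d) R, MvPolynomial.map (residue R) f = 0 →
      f • (Polynomial.monomial 1 (a * b) : Polynomial R) ∈ reesSubmodule x K := by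
    intro f hf n
    change (reesEval x f * _).coeff n ∈ _
    cases n with
    | zero => simp [Polynomial.mul_coeff_zero]
    | succ n =>
      rw [Polynomial.coeff_mul_monomial, coeff_reesEval]
      have h1 : ∀ m, coeff m (homogeneousComponent n f) ∈ maximalIdeal R := by
        intro m
        rw [coeff_homogeneousComponent]
        split_ifs
        · exact map_residue_eq_zero_iff.1 hf m
        · exact Ideal.zero_mem _
      have h2 := eval_mem_mul_span_pow (x := x) (homogeneousComponent_isHomogeneous n f) h1
      have h3 : maximalIdeal R * Ideal.span {a * b} ≤ K * J := by
        rw [mul_comm (maximalIdeal R), Ideal.span_singleton_mul_le_iff]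
        intro r hr
        rw [mul_comm (a * b)]; exact hsoc r hr
      have h4 := Ideal.mul_mem_mul h2 (Ideal.mem_span_singleton_self (a * b))
      rw [mul_right_comm] at h4
      have h5 := Ideal.mul_mono h3 (le_refl (J ^ n)) h4
      rwa [mul_assoc, ← pow_succ'] at h5
  have hbN : ∀ y ∈ reesSubmodule x K, Polynomial.monomial 1 b * y ∈ reesFiltration x K a b 1 := by
    intro y hy
    rw [← Polynomial.sum_monomial_eq y, Polynomial.sum, Finset.mul_sum]
    refine Submodule.sum_mem _ fun n _ => ?_
    rw [Polynomial.monomial_mul_monomial]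
    refine monomial_mem_reesFiltration ha hb hgen 1 n ?_
    rw [pow_one, mul_comm b, mul_right_comm]
    exact Ideal.mul_mem_mul (hy n) hb
  have hfree : ∀ j < s, ∀ f : MvPolynomial (Fin d) R,
      f • ((Polynomial.monomial 1 b) ^ j * Polynomial.monomial 1 (a * b)) ∈
        reesFiltration x K a b j → MvPolynomial.map (residue R) f = 0 := by
    intro j
    induction j using Nat.strong_induction_on with
    | _ j ih =>
      -- If freeness first fails at `j`, then `f` is a torsion relation; the generator lies in step
      -- `j`, and its coefficient in degree j + 1 contradicts `hs`.
      intro hj f hf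
      by_contra hf0
      have := isNoetherian_saturation_reesFiltration (K := K) (a := a) (b := b) hx hk j
      have h1 := pow_mul_mem_of_torsion (MvPolynomial.map_surjective _ residue_surjective)
        hbN hker hN j (fun i hi f hf => ih i hi (hi.trans hj) f hf) ⟨f, hf0, hf⟩
      have h2 := coeff_mem_of_mem_reesFiltration ha hb hJI j 1 h1
      rw [monomial_pow_mul, Polynomial.coeff_monomial, if_pos rfl, pow_one] at h2
      exact hs j hj h2
  refine hfree j hj F ?_
  rw [monomial_pow_mul]
  change reesEval x F * _ ∈ _
  rw [reesEval_of_isHomogeneous x hF, Polynomial.monomial_mul_monomial]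
  have := monomial_mem_reesFiltration ha hb hgen j (m + 1) hmem
  rwa [show m + (j + 1) = j + (m + 1) by ring]

end CyclicFiltrationRees

end AlmostMinimal

/-! ### Systems of parameters in a Cohen–Macaulay ring are regular sequences. -/

section CohenMacaulay

open IsLocalRing RingTheory.Sequence

open scoped Pointwise

universe u

variable {R : Type u} [CommRing R]

theorem ringKrullDim_quotient_add_one_le_of_lt {P Q : Ideal R} [P.IsPrime] (hPQ : P < Q) :
    ringKrullDim (R ⧸ Q) + 1 ≤ ringKrullDim (R ⧸ P) := by
  obtain ⟨y, hyQ, hyP⟩ := SetLike.exists_of_lt hPQ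
  have h1 := ringKrullDim_quotient_succ_le_of_nonZeroDivisor (R := R ⧸ P)
    (r := Ideal.Quotient.mk P y)
    (mem_nonZeroDivisors_of_ne_zero (by rwa [ne_eq, Ideal.Quotient.eq_zero_iff_mem]))
  refine le_trans (add_le_add_left ?_ 1) h1
  let f : (R ⧸ P) ⧸ Ideal.span {Ideal.Quotient.mk P y} →+* R ⧸ Q :=
    Ideal.Quotient.lift _ (Ideal.Quotient.factor hPQ.le) (by
      intro a ha
      obtain ⟨c, rfl⟩ := Ideal.mem_span_singleton'.1 ha
      rw [map_mul, Ideal.Quotient.factor_mk, Ideal.Quotient.eq_zero_iff_mem.2 hyQ, mul_zero])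
  refine ringKrullDim_le_of_surjective f ?_
  intro z
  obtain ⟨z, rfl⟩ := Ideal.Quotient.mk_surjective z
  exact ⟨Ideal.Quotient.mk _ (Ideal.Quotient.mk _ z), by simp [f]⟩

variable [IsNoetherianRing R] [IsLocalRing R]

/-- By Nakayama and the regularity of `y`, some `v` killed by P lies outside yM. Its class in M/yM
is killed by P and by y, and y ∉ P. -/
theorem exists_lt_mem_associatedPrimes_quotSMulTop {M : Type u} [AddCommGroup M] [Module R M]
    [Module.Finite R M] {P : Ideal R} (hP : P ∈ associatedPrimes R M) {y : R}
    (hy : y ∈ maximalIdeal R) (hreg : IsSMulRegular M y) :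
    ∃ Q ∈ associatedPrimes R (QuotSMulTop y M), P < Q := by
  obtain ⟨hPp, u, hu⟩ := (isAssociatedPrime_iff).1 hP
  have hu0 : u ≠ 0 := by
    rintro rfl
    apply hPp.ne_top
    rw [hu, Ideal.eq_top_iff_one, Submodule.mem_colon_singleton]
    simp
  let S : Submodule R M := Submodule.torsionBySet R M P
  have huS : u ∈ S := by
    rw [Submodule.mem_torsionBySet_iff]
    rintro ⟨a, ha⟩
    rw [hu] at ha
    simpa [Submodule.mem_colon_singleton] using ha
  have hnot : ¬ S ≤ y • (⊤ : Submodule R M) := by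
    intro hle
    have hS : S ≤ Ideal.span {y} • S := by
      intro v hv
      obtain ⟨w, -, rfl⟩ := (Submodule.mem_smul_pointwise_iff_exists _ _ _).1 (hle hv)
      refine Submodule.smul_mem_smul (Ideal.mem_span_singleton_self y) ?_
      rw [Submodule.mem_torsionBySet_iff] at hv ⊢
      intro a
      have := hv a
      rw [smul_comm] at this
      exact hreg (by simpa using this)
    have := Submodule.eq_bot_of_le_smul_of_le_jacobson_bot _ S (IsNoetherian.noetherian S) hS (by
      rw [IsLocalRing.jacobson_eq_maximalIdeal ⊥ bot_ne_top, Ideal.span_singleton_le_iff_mem]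
      exact hy)
    rw [this] at huS
    exact hu0 (by simpa using huS)
  obtain ⟨v, hvS, hv⟩ := SetLike.not_le_iff_exists.1 hnot
  have hv0 : (Submodule.Quotient.mk v : QuotSMulTop y M) ≠ 0 := by
    rwa [ne_eq, Submodule.Quotient.mk_eq_zero]
  obtain ⟨Q, hQ, hle⟩ := exists_le_isAssociatedPrime_of_isNoetherianRing R _ hv0
  refine ⟨Q, hQ, lt_of_le_of_ne ?_ ?_⟩
  · intro a ha
    apply hle
    rw [Submodule.mem_colon_singleton, Submodule.mem_bot, ← Submodule.Quotient.mk_smul]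
    have h0 : a • v = 0 := (Submodule.mem_torsionBySet_iff _ _).1 hvS ⟨a, ha⟩
    rw [h0, Submodule.Quotient.mk_zero]
  · intro hPQ
    have hyQ : y ∈ Q := by
      apply hle
      rw [Submodule.mem_colon_singleton, Submodule.mem_bot, ← Submodule.Quotient.mk_smul,
        Submodule.Quotient.mk_eq_zero]
      exact Submodule.smul_mem_pointwise_smul _ _ _ trivial
    rw [← hPQ, hu, Submodule.mem_colon_singleton, Submodule.mem_bot] at hyQ
    exact hu0 (hreg (by simpa using hyQ))

/-- Every regular element enlarges an associated prime strictly, which lowers the dimension of the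
quotient by at least one. -/
theorem length_le_ringKrullDim_of_isWeaklyRegular {rs : List R} {M : Type u} [AddCommGroup M]
    [Module R M] [Module.Finite R M] (hrs : IsWeaklyRegular M rs)
    (hmem : ∀ r ∈ rs, r ∈ maximalIdeal R) {P : Ideal R} (hP : P ∈ associatedPrimes R M) :
    (rs.length : WithBot ℕ∞) ≤ ringKrullDim (R ⧸ P) := by
  induction rs generalizing M P with
  | nil =>
    have := hP.isPrime
    have : Nontrivial (R ⧸ P) := Ideal.Quotient.nontrivial_iff.2 this.ne_top
    simpa using ringKrullDim_nonneg_of_nontrivial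
  | cons y rs ih =>
    rw [isWeaklyRegular_cons_iff] at hrs
    obtain ⟨Q, hQ, hPQ⟩ := exists_lt_mem_associatedPrimes_quotSMulTop hP
      (hmem y List.mem_cons_self) hrs.1
    have := hP.isPrime
    have h1 := ih hrs.2 (fun r hr => hmem r (List.mem_cons_of_mem _ hr)) hQ
    have h2 := ringKrullDim_quotient_add_one_le_of_lt hPQ
    rw [List.length_cons, Nat.cast_add, Nat.cast_one]
    exact (add_le_add_left h1 1).trans h2

/-- Krull's height theorem in R/P: the images of `xs` have the maximal ideal as a minimal prime. -/
theorem ringKrullDim_quotient_le_length {P : Ideal R} [hP : P.IsPrime] {xs : List R}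
    (hxs : ∀ x ∈ xs, x ∈ maximalIdeal R)
    (h : ∀ Q : Ideal R, Q.IsPrime → P ≤ Q → (∀ x ∈ xs, x ∈ Q) → Q = maximalIdeal R) :
    ringKrullDim (R ⧸ P) ≤ xs.length := by
  classical
  have : Nontrivial (R ⧸ P) := Ideal.Quotient.nontrivial_iff.2 hP.ne_top
  have : IsLocalRing (R ⧸ P) := IsLocalRing.of_surjective' _ Ideal.Quotient.mk_surjective
  rw [← IsLocalRing.maximalIdeal_height_eq_ringKrullDim]
  let s : Finset (R ⧸ P) := (xs.map (Ideal.Quotient.mk P)).toFinset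
  have hs : s.card ≤ xs.length := (List.toFinset_card_le _).trans (by simp)
  have hcomap : ∀ Q : Ideal (R ⧸ P), Q.IsPrime → (Ideal.span (s : Set (R ⧸ P)) ≤ Q) →
      Q.comap (Ideal.Quotient.mk P) = maximalIdeal R := by
    intro Q hQ hle
    refine h _ (Ideal.comap_isPrime _ _) ?_ ?_
    · intro p hp
      rw [Ideal.mem_comap, Ideal.Quotient.eq_zero_iff_mem.2 hp]; exact Q.zero_mem
    · intro x hx
      exact hle (Ideal.subset_span (by simp only [s, List.coe_toFinset, List.mem_map, Set.mem_ofPred_eq]; exact ⟨x, hx, rfl⟩))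
  have hmem : Ideal.span (s : Set (R ⧸ P)) ≤ maximalIdeal (R ⧸ P) := by
    rw [Ideal.span_le]
    intro z hz
    simp only [s, List.coe_toFinset, List.mem_map, Set.mem_ofPred_eq] at hz
    obtain ⟨x, hx, rfl⟩ := hz
    have := hxs x hx
    rw [SetLike.mem_coe, IsLocalRing.mem_maximalIdeal, mem_nonunits_iff]
    intro hu
    have hloc : IsLocalHom (Ideal.Quotient.mk P) :=
      IsLocalHom.of_surjective _ Ideal.Quotient.mk_surjective
    exact this (isUnit_of_map_unit _ _ hu)
  have hmin : maximalIdeal (R ⧸ P) ∈ (Ideal.span (s : Set (R ⧸ P))).minimalPrimes := by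
    refine ⟨⟨inferInstance, hmem⟩, fun Q hQ _ => ?_⟩
    rw [← Ideal.comap_le_comap_iff_of_surjective _ Ideal.Quotient.mk_surjective,
      hcomap Q hQ.1 hQ.2, hcomap _ inferInstance hmem]
  have h1 := Ideal.height_le_card_of_mem_minimalPrimes_span_finset hmin
  have h2 : (maximalIdeal (R ⧸ P)).height ≤ (xs.length : ℕ∞) :=
    h1.trans (by exact_mod_cast hs)
  exact_mod_cast h2

open CategoryTheory Abelian Limits in
-- Depth is measured by the vanishing of Ext groups, and the long exact sequence of 0 → M → M → M/xM
-- → 0 loses exactly one degree. Hence `x` need not belong to the given regular sequence.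
theorem exists_isRegular_quotSMulTop {M : Type u} [AddCommGroup M] [Module R M]
    [Module.Finite R M] [Nontrivial M] {x : R} (hx : x ∈ maximalIdeal R) (hreg : IsSMulRegular M x)
    {n : ℕ} (h : ∃ rs : List R, rs.length = n + 1 ∧ (∀ r ∈ rs, r ∈ maximalIdeal R) ∧
      IsRegular M rs) :
    ∃ rs : List R, rs.length = n ∧ (∀ r ∈ rs, r ∈ maximalIdeal R) ∧
      IsRegular (QuotSMulTop x M) rs := by
  have hlt : ∀ (L : Type u) [AddCommGroup L] [Module R L] [Module.Finite R L] [Nontrivial L],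
      maximalIdeal R • (⊤ : Submodule R L) < ⊤ := fun L _ _ _ _ =>
    lt_top_iff_ne_top.2 (Ne.symm (Submodule.top_ne_ideal_smul_of_le_jacobson_annihilator
      (maximalIdeal_le_jacobson _)))
  have := nontrivial_quotSMulTop_of_mem_maximalIdeal M hx
  have h1 := (((ModuleCat.exists_isRegular_tfae (maximalIdeal R) (n + 1) (ModuleCat.of R M)
    (hlt M)).out 3 1).1 h)
  refine (((ModuleCat.exists_isRegular_tfae (maximalIdeal R) n
    (ModuleCat.of R (QuotSMulTop x M)) (hlt _)).out 1 3).1 fun i hi => ?_)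
  have zero1 := AddCommGrpCat.isZero_of_iff_subsingleton.mpr (h1 i (by omega))
  have zero2 := AddCommGrpCat.isZero_of_iff_subsingleton.mpr (h1 (i + 1) (by omega))
  have hreg' : IsSMulRegular (ModuleCat.of R M) x := hreg
  exact AddCommGrpCat.subsingleton_of_isZero <| ShortComplex.Exact.isZero_of_both_zeros
    ((Ext.covariant_sequence_exact₃' _ hreg'.smulShortComplex_shortExact) i (i + 1) rfl)
    (zero1.eq_zero_of_src _) (zero2.eq_zero_of_tgt _)

/-- If `x` were a zero divisor on M it would lie in some associated prime P. The remaining elements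
then bound dim R/P by the length of `xs`, while the depth of M forces dim R/P to exceed that length
by one. -/
theorem isWeaklyRegular_of_isRegular {xs : List R} {M : Type u} [AddCommGroup M] [Module R M]
    [Module.Finite R M] [Nontrivial M]
    (hdepth : ∃ rs : List R, rs.length = xs.length ∧ (∀ r ∈ rs, r ∈ maximalIdeal R) ∧
      IsRegular M rs)
    (hxs : ∀ x ∈ xs, x ∈ maximalIdeal R)
    (hprim : ∀ Q : Ideal R, Q.IsPrime → Module.annihilator R M ≤ Q → (∀ x ∈ xs, x ∈ Q) →
      Q = maximalIdeal R) :
    IsWeaklyRegular M xs := by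
  induction xs generalizing M with
  | nil => exact .nil R M
  | cons x xs ih =>
    have hxm := hxs x List.mem_cons_self
    have hxs' : ∀ y ∈ xs, y ∈ maximalIdeal R := fun y hy => hxs y (List.mem_cons_of_mem _ hy)
    have hreg : IsSMulRegular M x := by
      by_contra hcon
      have hmem : x ∈ (⋃ p ∈ associatedPrimes R M, (p : Set R)) := by
        rw [biUnion_associatedPrimes_eq_compl_regular]; exact hcon
      simp only [Set.mem_iUnion] at hmem
      obtain ⟨P, hP, hxP⟩ := hmem
      have := hP.isPrime
      obtain ⟨rs, hlen, hrs, hrsreg⟩ := hdepth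
      have h1 := length_le_ringKrullDim_of_isWeaklyRegular hrsreg.toIsWeaklyRegular hrs hP
      have h2 := ringKrullDim_quotient_le_length (P := P) hxs' fun Q hQ hPQ hxsQ => by
        refine hprim Q hQ ((Submodule.annihilator_top (R := R) (M := M) ▸ hP.annihilator_le).trans hPQ) fun y hy => ?_
        rcases List.mem_cons.1 hy with rfl | hy
        · exact hPQ hxP
        · exact hxsQ y hy
      have h3 := h1.trans h2
      rw [hlen, List.length_cons] at h3
      have h4 : xs.length + 1 ≤ xs.length := by exact_mod_cast h3
      omega
    rw [isWeaklyRegular_cons_iff]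
    have := nontrivial_quotSMulTop_of_mem_maximalIdeal M hxm
    refine ⟨hreg, ih (exists_isRegular_quotSMulTop hxm hreg hdepth) hxs' fun Q hQ hann hxsQ => ?_⟩
    refine hprim Q hQ (le_trans ?_ hann) fun y hy => ?_
    · exact LinearMap.annihilator_le_of_surjective (Submodule.mkQ _) (Submodule.mkQ_surjective _)
    · rcases List.mem_cons.1 hy with rfl | hy
      · apply hann
        rw [Module.mem_annihilator]
        intro z
        obtain ⟨z, rfl⟩ := Submodule.mkQ_surjective _ z
        rw [← map_smul, Submodule.mkQ_apply, Submodule.Quotient.mk_eq_zero]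
        exact Submodule.smul_mem_pointwise_smul _ _ _ trivial
      · exact hxsQ y hy

theorem isQuasiRegularOn_of_isCohenMacaulayLocal (hCM : FiberCone.IsCohenMacaulayLocal R) {d : ℕ}
    (hd : ringKrullDim R = d) {x : Fin d → R}
    (hx : (Ideal.span (Set.range x)).radical = maximalIdeal R) :
    IsQuasiRegularOn x Set.univ := by
  have hxm : ∀ i, x i ∈ maximalIdeal R := fun i =>
    hx ▸ Ideal.le_radical (Ideal.subset_span (Set.mem_range_self i))
  have hdepth : ∃ rs : List R, rs.length = (List.ofFn x).length ∧
      (∀ r ∈ rs, r ∈ maximalIdeal R) ∧ IsRegular R rs := by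
    have h := hCM.2
    rw [hd] at h
    have h' : FiberCone.idealGrade (maximalIdeal R) = (d : ℕ∞) := by exact_mod_cast h
    rw [FiberCone.idealGrade] at h'
    have : Nonempty {rs : List R // IsRegular R rs ∧ ∀ r ∈ rs, r ∈ maximalIdeal R} :=
      ⟨⟨[], .nil R R, by simp⟩⟩
    obtain ⟨⟨rs, hrs, hmem⟩, hlen⟩ := ENat.exists_eq_iSup_of_lt_top
      (f := fun rs : {rs : List R // IsRegular R rs ∧ ∀ r ∈ rs, r ∈ maximalIdeal R} =>
        (rs.1.length : ℕ∞)) (by rw [h']; exact ENat.natCast_lt_top d)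
    rw [h'] at hlen
    exact ⟨rs, by rw [List.length_ofFn]; exact_mod_cast hlen, hmem, hrs⟩
  have hw := isWeaklyRegular_of_isRegular hdepth (by simpa [List.mem_ofFn] using hxm)
    fun Q hQ _ hxQ => by
      refine le_antisymm (le_maximalIdeal hQ.ne_top) ?_
      rw [← hx, hQ.radical_le_iff, Ideal.span_le]
      rintro _ ⟨i, rfl⟩
      exact hxQ _ ((List.mem_ofFn' _ _).2 ⟨i, rfl⟩)
  refine isQuasiRegularOn_univ_of_regular x fun i r hr => ?_
  have h1 := ((isWeaklyRegular_iff_Fin _ _).1 hw ⟨i, by simp⟩)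
  have h2 : (Ideal.ofList ((List.ofFn x).take i) • (⊤ : Submodule R R)) =
      Ideal.span (x '' {j | j < i}) := by
    rw [smul_eq_mul, Ideal.mul_top, Ideal.ofList]
    congr 1
    ext z
    simp only [Set.mem_ofPred_eq, List.mem_take_iff_getElem, List.getElem_ofFn, List.length_ofFn,
      Set.mem_image]
    constructor
    · rintro ⟨j, hj, rfl⟩
      exact ⟨⟨j, by omega⟩, Fin.lt_def.2 (by simp only; omega), rfl⟩
    · rintro ⟨j, hj, rfl⟩
      exact ⟨j, by have := Fin.lt_def.1 hj; omega, rfl⟩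
  rw [← h2] at hr ⊢
  rw [← Submodule.Quotient.mk_eq_zero] at hr ⊢
  refine h1 ?_
  simp only [Fin.getElem_fin, List.getElem_ofFn, smul_zero]
  rw [← Submodule.Quotient.mk_smul]
  exact hr

end CohenMacaulay

/-! ### Lengths of quotients by counting monomials. -/

section Length

open MvPolynomial

variable {R : Type*} [CommRing R]

theorem length_quotient_eq_add_length_quotient_comap {N : Type*} [AddCommGroup N] [Module R N]
    (f : N →ₗ[R] R) {A B : Ideal R} (h : B ⊔ LinearMap.range f = A) :
    Module.length R (R ⧸ B) =
      Module.length R (R ⧸ A) + Module.length R (N ⧸ Submodule.comap f B) := by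
  have hBA : B ≤ A := h ▸ le_sup_left
  rw [add_comm]
  have hker : Submodule.comap f B = LinearMap.ker (Submodule.mkQ B ∘ₗ f) := by
    rw [LinearMap.ker_comp, Submodule.ker_mkQ]
  refine Module.length_eq_add_of_exact ((Submodule.comap f B).liftQ (Submodule.mkQ B ∘ₗ f) hker.le)
    (Submodule.factor hBA) ?_ (Submodule.factor_surjective hBA) ?_
  · rw [← LinearMap.ker_eq_bot]
    exact Submodule.ker_liftQ_eq_bot _ _ _ hker.ge
  · intro z
    obtain ⟨z, rfl⟩ := Submodule.mkQ_surjective _ z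
    constructor
    · intro hz
      have hzA : z ∈ A := by
        exact (Submodule.Quotient.mk_eq_zero A).1 hz
      rw [← h] at hzA
      obtain ⟨b, hb, _, ⟨n, rfl⟩, rfl⟩ := Submodule.mem_sup.1 hzA
      refine ⟨Submodule.mkQ _ n, ?_⟩
      rw [Submodule.mkQ_apply, Submodule.liftQ_apply, map_add, LinearMap.comp_apply,
        Submodule.mkQ_apply B b, (Submodule.Quotient.mk_eq_zero B).2 hb, zero_add]
    · rintro ⟨n, hn⟩
      obtain ⟨n, rfl⟩ := Submodule.mkQ_surjective _ n
      rw [← hn, Submodule.mkQ_apply, Submodule.liftQ_apply, LinearMap.comp_apply,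
        Submodule.mkQ_apply]
      refine (Submodule.Quotient.mk_eq_zero A).2 ?_
      exact h ▸ Submodule.mem_sup_right ⟨n, rfl⟩

theorem length_quotient_eq_add {A B : Ideal R} (h : B ≤ A) :
    Module.length R (R ⧸ B) = Module.length R (R ⧸ A) + FiberCone.quotLength A B :=
  length_quotient_eq_add_length_quotient_comap A.subtype (by simpa using h)

theorem length_quotient_pi {ι : Type*} [Fintype ι] (𝔞 : Ideal R) :
    Module.length R ((ι → R) ⧸ Submodule.pi Set.univ fun _ : ι => 𝔞) =
      Fintype.card ι * Module.length R (R ⧸ 𝔞) := by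
  classical
  rw [(Submodule.quotientPi (R := R) fun _ : ι => (𝔞 : Submodule R R)).length_eq, Module.length_pi]
  simp

section Span

variable {ι : Type*} [Fintype ι] {A B 𝔞 : Ideal R} (e : ι → R)

theorem range_linearCombination_eq (e : ι → R) :
    LinearMap.range (Fintype.linearCombination R e) = Ideal.span (Set.range e) :=
  Fintype.range_linearCombination R e

theorem length_quotient_eq_add_card_mul (hA : B ⊔ Ideal.span (Set.range e) = A)
    (he : ∀ c : ι → R, ∑ i, c i * e i ∈ B ↔ ∀ i, c i ∈ 𝔞) :
    Module.length R (R ⧸ B) =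
      Module.length R (R ⧸ A) + Fintype.card ι * Module.length R (R ⧸ 𝔞) := by
  rw [length_quotient_eq_add_length_quotient_comap (Fintype.linearCombination R e)
    (A := A) (by rw [range_linearCombination_eq, hA]), ← length_quotient_pi]
  have : Submodule.comap (Fintype.linearCombination R e) B =
      Submodule.pi Set.univ fun _ : ι => 𝔞 := by
    ext c
    simpa [Fintype.linearCombination_apply] using he c
  rw [this]

theorem length_quotient_le_add_card_mul (hA : B ⊔ Ideal.span (Set.range e) = A)
    (he : ∀ c : ι → R, (∀ i, c i ∈ 𝔞) → ∑ i, c i * e i ∈ B) :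
    Module.length R (R ⧸ B) ≤
      Module.length R (R ⧸ A) + Fintype.card ι * Module.length R (R ⧸ 𝔞) := by
  rw [length_quotient_eq_add_length_quotient_comap (Fintype.linearCombination R e)
    (A := A) (by rw [range_linearCombination_eq, hA]), ← length_quotient_pi]
  have : Submodule.pi Set.univ (fun _ : ι => 𝔞) ≤
      Submodule.comap (Fintype.linearCombination R e) B := by
    intro c hc
    simpa [Fintype.linearCombination_apply] using he c (by simpa using hc)
  gcongr
  exact Module.length_le_of_surjective (Submodule.factor this) (Submodule.factor_surjective this)

end Span

section FormLength

variable {d : ℕ} (x : Fin d → R) (c : R) (n : ℕ) {A B 𝔞 : Ideal R}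

/-- The products of `c` with the monomials of degree `n` in the elements `x i`. -/
noncomputable def monomialFamily (m : (Finset.univ : Finset (Fin d)).finsuppAntidiag n) : R :=
  eval x (monomial m.1 1) * c

theorem degree_of_mem_finsuppAntidiag {n : ℕ} {m : Fin d →₀ ℕ} :
    m ∈ (Finset.univ : Finset (Fin d)).finsuppAntidiag n ↔ m.degree = n := by
  rw [Finset.mem_finsuppAntidiag, Finsupp.degree_eq_sum]
  simp

theorem card_finsuppAntidiag_fin :
    Fintype.card ((Finset.univ : Finset (Fin d)).finsuppAntidiag n) = d.multichoose n := by
  rw [Fintype.card_coe, Finset.card_finsuppAntidiag_nat_eq_multichoose]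
  simp

theorem exists_form_of_sum (α : (Finset.univ : Finset (Fin d)).finsuppAntidiag n → R) :
    ∃ F : MvPolynomial (Fin d) R, F.IsHomogeneous n ∧ (∀ m, coeff m.1 F = α m) ∧
      (∀ m, m ∉ (Finset.univ : Finset (Fin d)).finsuppAntidiag n → coeff m F = 0) ∧
      ∑ m, α m * monomialFamily x c n m = eval x F * c := by
  classical
  have hco : ∀ m', coeff m' (∑ m, monomial m.1 (α m)) =
      ∑ m, if m.1 = m' then α m else 0 := fun m' => by
    rw [coeff_sum]; simp only [coeff_monomial]
  refine ⟨∑ m, monomial m.1 (α m), ?_, ?_, ?_, ?_⟩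
  · exact IsHomogeneous.sum _ _ _ fun m _ =>
      isHomogeneous_monomial _ (degree_of_mem_finsuppAntidiag.1 m.2)
  · intro m
    rw [hco, Finset.sum_eq_single m (fun m' _ hne => if_neg fun h => hne (Subtype.ext h))
      (fun h => absurd (Finset.mem_univ m) h), if_pos rfl]
  · intro m hm
    rw [hco]
    exact Finset.sum_eq_zero fun m' _ => if_neg fun h : m'.1 = m => hm (h ▸ m'.2)
  · rw [map_sum, Finset.sum_mul]
    refine Finset.sum_congr rfl fun m _ => ?_
    rw [monomialFamily, eval_monomial, eval_monomial]
    ring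

theorem span_range_monomialFamily :
    Ideal.span (Set.range (monomialFamily x c n)) =
      Ideal.span (Set.range x) ^ n * Ideal.span {c} := by
  apply le_antisymm
  · rw [Ideal.span_le]
    rintro _ ⟨m, rfl⟩
    exact Ideal.mul_mem_mul (eval_mem_span_pow (isHomogeneous_monomial _
      (degree_of_mem_finsuppAntidiag.1 m.2))) (Ideal.mem_span_singleton_self c)
  · intro z hz
    obtain ⟨w, hw, rfl⟩ := Ideal.mem_mul_span_singleton.1 hz
    obtain ⟨F, hF, rfl⟩ := exists_isHomogeneous_of_mem_span_pow hw
    rw [eval_eq, Finset.sum_mul]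
    refine Ideal.sum_mem _ fun m hm => ?_
    rw [mul_assoc]
    refine Ideal.mul_mem_left _ _ (Ideal.subset_span ⟨⟨m, degree_of_mem_finsuppAntidiag.2
      (degree_eq_of_isHomogeneous hF (mem_support_iff.1 hm))⟩, ?_⟩)
    rw [monomialFamily, eval_monomial, one_mul]
    rfl

/-- A/B is the image of the free module on the monomials of degree `n`, and by hypothesis the kernel
consists of the vectors with all entries in `𝔞`. -/
theorem length_quotient_eq_of_forms (hA : B ⊔ Ideal.span (Set.range x) ^ n * Ideal.span {c} = A)
    (h : ∀ F : MvPolynomial (Fin d) R, F.IsHomogeneous n →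
      (eval x F * c ∈ B ↔ ∀ m, coeff m F ∈ 𝔞)) :
    Module.length R (R ⧸ B) =
      Module.length R (R ⧸ A) + d.multichoose n * Module.length R (R ⧸ 𝔞) := by
  rw [← card_finsuppAntidiag_fin]
  refine length_quotient_eq_add_card_mul (monomialFamily x c n)
    (by rwa [span_range_monomialFamily]) fun α => ?_
  obtain ⟨F, hF, hα, h0, hsum⟩ := exists_form_of_sum x c n α
  rw [hsum, h F hF]
  constructor
  · intro hm m
    rw [← hα]; exact hm _
  · intro hm m
    by_cases hmem : m ∈ (Finset.univ : Finset (Fin d)).finsuppAntidiag n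
    · rw [hα ⟨m, hmem⟩]; exact hm _
    · rw [h0 m hmem]; exact Ideal.zero_mem _

theorem length_quotient_le_of_forms (hA : B ⊔ Ideal.span (Set.range x) ^ n * Ideal.span {c} = A)
    (h : ∀ F : MvPolynomial (Fin d) R, F.IsHomogeneous n →
      (∀ m, coeff m F ∈ 𝔞) → eval x F * c ∈ B) :
    Module.length R (R ⧸ B) ≤
      Module.length R (R ⧸ A) + d.multichoose n * Module.length R (R ⧸ 𝔞) := by
  rw [← card_finsuppAntidiag_fin]
  refine length_quotient_le_add_card_mul (monomialFamily x c n)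
    (by rwa [span_range_monomialFamily]) fun α hmα => ?_
  obtain ⟨F, hF, hα, h0, hsum⟩ := exists_form_of_sum x c n α
  rw [hsum]
  refine h F hF fun m => ?_
  by_cases hmem : m ∈ (Finset.univ : Finset (Fin d)).finsuppAntidiag n
  · rw [hα ⟨m, hmem⟩]; exact hmα _
  · rw [h0 m hmem]; exact Ideal.zero_mem _

/-- Subadditive bound for the colength of the powers of an ideal with `d` generators. -/
theorem length_quotient_span_pow_le :
    Module.length R (R ⧸ Ideal.span (Set.range x) ^ n) ≤
      (∑ i ∈ Finset.range n, d.multichoose i : ℕ) *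
        Module.length R (R ⧸ Ideal.span (Set.range x)) := by
  induction n with
  | zero =>
    rw [pow_zero, Ideal.one_eq_top, Module.length_eq_zero]
    exact zero_le
  | succ n ih =>
    refine (length_quotient_le_of_forms x 1 n (A := Ideal.span (Set.range x) ^ n)
      (𝔞 := Ideal.span (Set.range x)) ?_ ?_).trans ?_
    · rw [Ideal.span_singleton_one, Ideal.mul_top]
      exact sup_eq_right.2 (Ideal.pow_le_pow_right n.le_succ)
    · intro F hF hc
      rw [mul_one, pow_succ']
      exact eval_mem_mul_span_pow hF hc
    · rw [Finset.sum_range_succ, Nat.cast_add, add_mul]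
      gcongr

theorem sum_range_succ_multichoose (d n : ℕ) :
    ∑ i ∈ Finset.range (n + 1), d.multichoose i = (d + 1).multichoose n := by
  induction n with
  | zero => simp
  | succ n ih => rw [Finset.sum_range_succ, ih, Nat.multichoose_succ_succ, add_comm]

end FormLength

end Length

/-! ### Minimal reductions are generated by d elements. -/

section MinimalReduction

open MvPolynomial IsLocalRing

section Substitution

variable {ι R : Type*} [CommRing R]

theorem eval_mul_right_of_isHomogeneous {n : ℕ} {F : MvPolynomial ι R} (hF : F.IsHomogeneous n)
    (u : ι → R) (y : R) : eval (fun i => u i * y) F = y ^ n * eval u F := by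
  rw [eval_eq, eval_eq, Finset.mul_sum]
  refine Finset.sum_congr rfl fun m hm => ?_
  have hdeg := degree_eq_of_isHomogeneous hF (mem_support_iff.1 hm)
  simp only [mul_pow]
  rw [Finset.prod_mul_distrib, Finset.prod_pow_eq_pow_sum, ← hdeg, Finsupp.degree_apply]
  ring

theorem Multiset.prod_map_sub_prod_map_mem {A J : Ideal R} {x w : ι → R}
    (hxw : ∀ i, x i - w i ∈ A) (hx : ∀ i, x i ∈ J) (hw : ∀ i, w i ∈ J) (t : Multiset ι) :
    (t.map x).prod - (t.map w).prod ∈ A * J ^ (t.card - 1) := by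
  induction t using Multiset.induction with
  | empty => simp
  | cons i t ih =>
    have hmem : ∀ t : Multiset ι, (t.map x).prod ∈ J ^ t.card := fun t => by
      induction t using Multiset.induction with
      | empty => simp
      | cons i t ih =>
        rw [Multiset.map_cons, Multiset.prod_cons, Multiset.card_cons, pow_succ']
        exact Ideal.mul_mem_mul (hx i) ih
    rw [Multiset.map_cons, Multiset.prod_cons, Multiset.map_cons, Multiset.prod_cons,
      Multiset.card_cons, Nat.add_sub_cancel,
      show x i * (t.map x).prod - w i * (t.map w).prod =
        (x i - w i) * (t.map x).prod + w i * ((t.map x).prod - (t.map w).prod) by ring]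
    refine Ideal.add_mem _ (Ideal.mul_mem_mul (hxw i) (hmem t)) ?_
    rcases Nat.eq_zero_or_pos t.card with h0 | h0
    · rw [Multiset.card_eq_zero.1 h0]; simp
    · obtain ⟨k, hk⟩ := Nat.exists_eq_add_of_lt h0
      rw [zero_add] at hk
      rw [hk, Nat.add_sub_cancel] at ih
      rw [hk, pow_succ', mul_left_comm]
      exact Ideal.mul_mem_mul (hw i) ih

theorem eval_sub_eval_mem {A J : Ideal R} {x w : ι → R} (hxw : ∀ i, x i - w i ∈ A)
    (hx : ∀ i, x i ∈ J) (hw : ∀ i, w i ∈ J) {n : ℕ} {F : MvPolynomial ι R}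
    (hF : F.IsHomogeneous (n + 1)) : eval x F - eval w F ∈ A * J ^ n := by
  rw [eval_eq, eval_eq, ← Finset.sum_sub_distrib]
  refine Ideal.sum_mem _ fun m hm => ?_
  rw [← mul_sub]
  refine Ideal.mul_mem_left _ _ ?_
  have hdeg := degree_eq_of_isHomogeneous hF (mem_support_iff.1 hm)
  have hprod : ∀ v : ι → R, ∏ i ∈ m.support, v i ^ m i = ((Finsupp.toMultiset m).map v).prod :=
    fun v => by
      rw [Finsupp.toMultiset_map, Finsupp.prod_toMultiset, Finsupp.prod_mapDomain_index (by simp)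
        (by intro _ _ _; exact pow_add _ _ _)]
      rfl
  rw [hprod, hprod]
  have := Multiset.prod_map_sub_prod_map_mem hxw hx hw (Finsupp.toMultiset m)
  rwa [Finsupp.card_toMultiset, show (m.sum fun _ => id) = n + 1 from hdeg,
    Nat.add_sub_cancel] at this

end Substitution

section Reduction

variable {R : Type*} [CommRing R]

theorem FiberCone.IsReduction.of_pow_le {A J I : Ideal R} (hAJ : A ≤ J)
    (hJ : FiberCone.IsReduction J I) {n : ℕ} (h : J ^ (n + 1) ≤ A * J ^ n) :
    FiberCone.IsReduction A I := by
  obtain ⟨hJI, r, hr⟩ := hJ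
  have hpow : ∀ k, J ^ k * I ^ r = I ^ (r + k) := fun k => by
    induction k with
    | zero => simp
    | succ k ih => rw [pow_succ', mul_assoc, ih, pow_add, ← mul_assoc, hr, ← pow_add]; congr 1; ring
  refine ⟨hAJ.trans hJI, r + n, ?_⟩
  rw [← hpow, ← mul_assoc, add_assoc, ← hpow]
  refine le_antisymm (Ideal.mul_mono ?_ le_rfl) (Ideal.mul_mono h le_rfl)
  rw [pow_succ']
  exact Ideal.mul_mono hAJ le_rfl

end Reduction

section Local

variable {R : Type*} [CommRing R] [IsLocalRing R]

/-- Replacing every x_i by u_i x_{i₀} changes the value of a form of degree n + 1 by an element of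
A·J^n. For F this puts x_{i₀}^{n+1} into A·J^n + 𝔪J^{n+1}, hence all values of forms of that degree,
and Nakayama finishes. -/
theorem pow_add_le_of_form [IsNoetherianRing R] {ν n : ℕ} {x : Fin ν → R} {A : Ideal R} {u : Fin ν → R} {i₀ : Fin ν}
    (hA : ∀ i, x i - u i * x i₀ ∈ A) {F : MvPolynomial (Fin ν) R} (hF : F.IsHomogeneous (n + 1))
    (hev : eval x F ∈ maximalIdeal R * Ideal.span (Set.range x) ^ (n + 1))
    (hu : IsUnit (eval u F)) :
    Ideal.span (Set.range x) ^ (n + 1) ≤ A * Ideal.span (Set.range x) ^ n := by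
  set J := Ideal.span (Set.range x)
  have hx : ∀ i, x i ∈ J := fun i => Ideal.subset_span ⟨i, rfl⟩
  have hw : ∀ i, u i * x i₀ ∈ J := fun i => Ideal.mul_mem_left _ _ (hx i₀)
  refine Submodule.le_of_le_smul_of_le_jacobson_bot (I := maximalIdeal R)
    (IsNoetherian.noetherian _) (IsLocalRing.maximalIdeal_le_jacobson _) ?_
  have hy : x i₀ ^ (n + 1) ∈ A * J ^ n ⊔ maximalIdeal R * J ^ (n + 1) := by
    have h1 := eval_sub_eval_mem hA hx hw hF
    rw [eval_mul_right_of_isHomogeneous hF u] at h1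
    have h2 : x i₀ ^ (n + 1) * eval u F ∈ A * J ^ n ⊔ maximalIdeal R * J ^ (n + 1) := by
      rw [show x i₀ ^ (n + 1) * eval u F =
        -(eval x F - x i₀ ^ (n + 1) * eval u F) + eval x F by ring]
      exact Ideal.add_mem _ (Submodule.mem_sup_left (neg_mem h1)) (Submodule.mem_sup_right hev)
    exact (Ideal.mul_unit_mem_iff_mem _ hu).1 h2
  intro z hz
  obtain ⟨G, hG, rfl⟩ := exists_isHomogeneous_of_mem_span_pow hz
  have h1 := eval_sub_eval_mem hA hx hw hG
  rw [eval_mul_right_of_isHomogeneous hG u] at h1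
  rw [show eval x G = (eval x G - x i₀ ^ (n + 1) * eval u G) + eval u G * x i₀ ^ (n + 1) by ring]
  exact Ideal.add_mem _ (Submodule.mem_sup_left h1) (Ideal.mul_mem_left _ _ hy)

/-- Over the infinite residue field the form has a point where it does not vanish; homogeneity
allows one nonzero coordinate of it to be scaled to 1. -/
theorem exists_eval_isUnit_of_map_residue_ne_zero [Infinite (ResidueField R)] {ν n : ℕ}
    {F : MvPolynomial (Fin ν) R} (hF : F.IsHomogeneous (n + 1)) (h : map (residue R) F ≠ 0) :
    ∃ (u : Fin ν → R) (i₀ : Fin ν), u i₀ = 1 ∧ IsUnit (eval u F) := by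
  have hFk : (map (residue R) F).IsHomogeneous (n + 1) := hF.map _
  obtain ⟨c, hc⟩ : ∃ c, eval c (map (residue R) F) ≠ 0 := by
    by_contra! hcon
    exact h (MvPolynomial.funext fun c => by rw [hcon, map_zero])
  obtain ⟨i₀, hi₀⟩ : ∃ i, c i ≠ 0 := by
    by_contra! hcon
    apply hc
    have := eval_mul_right_of_isHomogeneous hFk c 0
    rw [zero_pow (Nat.succ_ne_zero n), zero_mul] at this
    rw [← this]
    congr 2
    funext i
    rw [hcon, zero_mul]
  choose l hl using fun i => residue_surjective (R := R) (c i * (c i₀)⁻¹)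
  refine ⟨Function.update l i₀ 1, i₀, Function.update_self .., ?_⟩
  rw [← residue_ne_zero_iff_isUnit]
  have hres : ∀ i, residue R (Function.update l i₀ 1 i) = c i * (c i₀)⁻¹ := fun i => by
    rcases eq_or_ne i i₀ with rfl | hne
    · rw [Function.update_self, map_one, mul_inv_cancel₀ hi₀]
    · rw [Function.update_of_ne hne, hl]
  have : residue R (eval (Function.update l i₀ 1) F) =
      eval (fun i => c i * (c i₀)⁻¹) (map (residue R) F) := by
    rw [eval_map, ← funext hres, eval, coe_eval₂Hom, hom_eval₂ ]
    rfl
  rw [this, eval_mul_right_of_isHomogeneous hFk]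
  exact mul_ne_zero (pow_ne_zero _ (inv_ne_zero hi₀)) hc

/-- The fiber ring of a minimal reduction is a polynomial ring. A nontrivial relation would produce
a reduction inside J with one generator fewer; by minimality it equals J, against the least choice
of `ν`. -/
theorem exists_minimal_generators_of_isMinimalReduction [IsNoetherianRing R]
    [Infinite (ResidueField R)] {I J : Ideal R}
    (hJ : FiberCone.IsMinimalReduction J I) :
    ∃ (ν : ℕ) (x : Fin ν → R), Ideal.span (Set.range x) = J ∧
      ∀ (n : ℕ) (F : MvPolynomial (Fin ν) R), F.IsHomogeneous n →
        eval x F ∈ maximalIdeal R * Ideal.span (Set.range x) ^ n →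
          ∀ m, coeff m F ∈ maximalIdeal R := by
  classical
  have hex : ∃ ν : ℕ, ∃ x : Fin ν → R, Ideal.span (Set.range x) = J := by
    obtain ⟨ν, x, hx⟩ := Submodule.fg_iff_exists_fin_generating_family.1 (IsNoetherian.noetherian J)
    exact ⟨ν, x, hx⟩
  obtain ⟨x, hx⟩ := Nat.find_spec hex
  refine ⟨Nat.find hex, x, hx, fun n F hF hev => ?_⟩
  rw [← map_residue_eq_zero_iff]
  by_contra hne
  cases n with
  | zero =>
    rw [pow_zero, Ideal.one_eq_top, Ideal.mul_top] at hev
    apply hne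
    rw [eval_of_isHomogeneous_zero x hF, map_C, (residue_eq_zero_iff _).2 hev, C_0]
  | succ n =>
    obtain ⟨u, i₀, hu₀, hu⟩ := exists_eval_isUnit_of_map_residue_ne_zero hF hne
    have hmin : ∀ ν', ν' < Nat.find hex → ¬ ∃ x : Fin ν' → R, Ideal.span (Set.range x) = J :=
      fun ν' h => Nat.find_min hex h
    generalize Nat.find hex = ν at x F u i₀ hmin
    cases ν with
    | zero => exact i₀.elim0
    | succ ν =>
      let y : Fin ν → R := fun j => x (i₀.succAbove j) - u (i₀.succAbove j) * x i₀
      have hA : ∀ i, x i - u i * x i₀ ∈ Ideal.span (Set.range y) := fun i => by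
        rcases Fin.eq_self_or_eq_succAbove i₀ i with rfl | ⟨j, rfl⟩
        · rw [hu₀, one_mul, sub_self]; exact Ideal.zero_mem _
        · exact Ideal.subset_span ⟨j, rfl⟩
      have hyJ : Ideal.span (Set.range y) ≤ J := by
        rw [Ideal.span_le]
        rintro _ ⟨j, rfl⟩
        rw [← hx]
        exact Ideal.sub_mem _ (Ideal.subset_span ⟨_, rfl⟩)
          (Ideal.mul_mem_left _ _ (Ideal.subset_span ⟨_, rfl⟩))
      have hle := pow_add_le_of_form hA hF hev hu
      rw [hx] at hle
      have hred := FiberCone.IsReduction.of_pow_le hyJ hJ.1 hle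
      exact hmin ν ν.lt_succ_self ⟨y, le_antisymm hyJ (hJ.2 hred hyJ)⟩

end Local

section Length

variable {R : Type*} [CommRing R]

theorem length_quotient_anti {A B : Ideal R} (h : B ≤ A) :
    Module.length R (R ⧸ A) ≤ Module.length R (R ⧸ B) :=
  Module.length_le_of_surjective (Submodule.factor h) (Submodule.factor_surjective h)

variable [IsLocalRing R]

theorem length_quotient_maximalIdeal : Module.length R (R ⧸ maximalIdeal R) = 1 := by
  rw [Module.length_eq_one_iff]
  exact isSimpleModule_iff_isCoatom.2 (maximalIdeal.isMaximal R).out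

theorem length_quotient_ne_top [IsNoetherianRing R] {A : Ideal R} {k : ℕ} (h : maximalIdeal R ^ k ≤ A) :
    Module.length R (R ⧸ A) ≠ ⊤ := by
  obtain ⟨ν, y, hy⟩ := Submodule.fg_iff_exists_fin_generating_family.1
    (IsNoetherian.noetherian (maximalIdeal R))
  have hle := (length_quotient_anti h).trans
    ((show Ideal.span (Set.range y) = maximalIdeal R from hy) ▸ length_quotient_span_pow_le y k)
  rw [length_quotient_maximalIdeal, mul_one] at hle
  exact ne_top_of_le_ne_top (ENat.natCast_ne_top _) hle

theorem le_length_quotient_pow {ν : ℕ} {x : Fin ν → R}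
    (hx : ∀ i, x i ∈ maximalIdeal R)
    (h : ∀ (n : ℕ) (F : MvPolynomial (Fin ν) R), F.IsHomogeneous n →
        eval x F ∈ maximalIdeal R * Ideal.span (Set.range x) ^ n →
          ∀ m, coeff m F ∈ maximalIdeal R) (n : ℕ) :
    ((∑ i ∈ Finset.range n, ν.multichoose i : ℕ) : ℕ∞) ≤
      Module.length R (R ⧸ Ideal.span (Set.range x) ^ n) := by
  induction n with
  | zero => simp
  | succ n ih =>
    have hJ : Ideal.span (Set.range x) ≤ maximalIdeal R := by
      rw [Ideal.span_le]; rintro _ ⟨i, rfl⟩; exact hx i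
    have h1 := length_quotient_eq_of_forms x 1 n (A := Ideal.span (Set.range x) ^ n)
      (B := maximalIdeal R * Ideal.span (Set.range x) ^ n) (𝔞 := maximalIdeal R) (by
        rw [Ideal.span_singleton_one, Ideal.mul_top]
        exact sup_eq_right.2 Ideal.mul_le_right) (fun F hF => by
          rw [mul_one]
          exact ⟨fun hev => h n F hF hev, fun hc => eval_mem_mul_span_pow hF hc⟩)
    rw [length_quotient_maximalIdeal, mul_one] at h1
    rw [Finset.sum_range_succ, Nat.cast_add]
    calc _ ≤ Module.length R (R ⧸ Ideal.span (Set.range x) ^ n) + (ν.multichoose n : ℕ∞) := by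
          gcongr
      _ = _ := h1.symm
      _ ≤ _ := length_quotient_anti (by rw [pow_succ']; exact Ideal.mul_mono hJ le_rfl)

/-- The left side grows in n like a polynomial of degree ν, the right side like one of degree d. -/
theorem le_of_multichoose_le {ν d c L : ℕ}
    (h : ∀ n, (ν + 1).multichoose n ≤ (d + 1).multichoose (c * (n + 1)) * L) : ν ≤ d := by
  by_contra! hlt
  have key : ∀ n, (n + 1) ^ (d + 1) ≤ (n + 1) ^ d * ((c + d) ^ d * L * (d + 1).factorial) := by
    intro n
    have hmono : (d + 2).multichoose n ≤ (ν + 1).multichoose n := by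
      rw [Nat.multichoose_eq, Nat.multichoose_eq]
      exact Nat.choose_le_choose _ (by omega)
    have h1 : (n + 1) ^ (d + 1) ≤ (d + 1).factorial * (d + 2).multichoose n := by
      rw [Nat.multichoose_eq, show d + 2 + n - 1 = n + (d + 1) by omega, Nat.choose_symm_add,
        ← Nat.descFactorial_eq_factorial_mul_choose]
      have := Nat.pow_sub_le_descFactorial (n + (d + 1)) (d + 1)
      rwa [show n + (d + 1) + 1 - (d + 1) = n + 1 by omega] at this
    have h2 : (d + 1).multichoose (c * (n + 1)) ≤ (c + d) ^ d * (n + 1) ^ d := by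
      rw [Nat.multichoose_eq, show d + 1 + c * (n + 1) - 1 = c * (n + 1) + d by omega,
        Nat.choose_symm_add, ← mul_pow]
      refine (Nat.choose_le_pow _ _).trans (Nat.pow_le_pow_left ?_ d)
      nlinarith [Nat.zero_le (d * n)]
    calc _ ≤ (d + 1).factorial * (((c + d) ^ d * (n + 1) ^ d) * L) :=
          h1.trans (Nat.mul_le_mul_left _ (hmono.trans ((h n).trans (Nat.mul_le_mul_right _ h2))))
      _ = _ := by ring
  have := key ((c + d) ^ d * L * (d + 1).factorial)
  rw [pow_succ] at this
  have := Nat.le_of_mul_le_mul_left this (by positivity)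
  omega

end Length

section Krull

variable {R : Type*} [CommRing R] [IsLocalRing R]

theorem radical_eq_maximalIdeal_iff {A : Ideal R} :
    A.radical = maximalIdeal R ↔ maximalIdeal R ∈ A.minimalPrimes := by
  constructor
  · intro h
    rw [← Ideal.radical_minimalPrimes, h, Ideal.minimalPrimes_eq_subsingleton_self]
    rfl
  · intro h
    rw [← Ideal.sInf_minimalPrimes]
    apply le_antisymm (sInf_le h)
    refine le_sInf fun p hp => ?_
    have := hp.1.1
    exact h.2 hp.1 (IsLocalRing.le_maximalIdeal this.ne_top)

theorem radical_eq_of_isReduction {I J : Ideal R} (hI : I.radical = maximalIdeal R)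
    (hJ : FiberCone.IsReduction J I) : J.radical = maximalIdeal R := by
  obtain ⟨hJI, n, hn⟩ := hJ
  rw [← hI]
  refine le_antisymm (Ideal.radical_mono hJI) (Ideal.radical_le_radical_iff.2 fun z hz => ?_)
  exact ⟨n + 1, Ideal.mul_le_left (hn ▸ Ideal.pow_mem_pow hz _ : z ^ (n + 1) ∈ J * I ^ n)⟩

theorem exists_maximalIdeal_pow_le [IsNoetherianRing R] {A : Ideal R} (h : A.radical = maximalIdeal R) :
    ∃ k, maximalIdeal R ^ k ≤ A := by
  rw [← h]
  exact Ideal.exists_radical_pow_le_of_fg _ (IsNoetherian.noetherian _)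

/-- A minimal reduction of an `𝔪`-primary ideal is generated by a system of parameters. -/
theorem exists_generators_of_isMinimalReduction [IsNoetherianRing R] [Infinite (ResidueField R)] {d : ℕ}
    (hd : ringKrullDim R = d) {I J : Ideal R} (hI : I.radical = maximalIdeal R)
    (hJ : FiberCone.IsMinimalReduction J I) :
    ∃ x : Fin d → R, Ideal.span (Set.range x) = J := by
  classical
  have hrad := radical_eq_of_isReduction hI hJ.1
  have hht : (maximalIdeal R).height = d := by
    have := IsLocalRing.maximalIdeal_height_eq_ringKrullDim (R := R)
    rw [hd] at this
    exact_mod_cast this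
  obtain ⟨ν, x, hx, h⟩ := exists_minimal_generators_of_isMinimalReduction hJ
  have hmem : ∀ i, x i ∈ maximalIdeal R := fun i => by
    rw [← hrad, ← hx]
    exact Ideal.le_radical (Ideal.subset_span ⟨i, rfl⟩)
  have hdν : d ≤ ν := by
    have h1 : maximalIdeal R ∈ (Ideal.span (Set.range x)).minimalPrimes := by
      rw [hx]; exact radical_eq_maximalIdeal_iff.1 hrad
    have h2 := Ideal.height_le_card_of_mem_minimalPrimes_span (Set.finite_range x) h1
    rw [hht] at h2
    have h3 : (Set.range x).ncard ≤ ν := by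
      rw [← Set.image_univ]
      refine (Set.ncard_image_le Set.finite_univ).trans ?_
      rw [Set.ncard_univ, Nat.card_eq_fintype_card, Fintype.card_fin]
    exact (by exact_mod_cast h2 : d ≤ _).trans h3
  have hνd : ν ≤ d := by
    -- A system of parameters `q` with d elements bounds the growth of λ(R/J^n) from above, while
    -- the polynomial fiber ring in ν variables bounds it from below.
    obtain ⟨t, ht, htc⟩ := Ideal.exists_finset_card_eq_height_of_isNoetherianRing (maximalIdeal R)
    rw [hht] at htc
    have htc : t.card = d := by exact_mod_cast htc
    let q : Fin d → R := fun i => t.equivFin.symm (Fin.cast htc.symm i)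
    have hq : Set.range q = t := by
      ext z
      constructor
      · rintro ⟨i, rfl⟩; exact (t.equivFin.symm _).2
      · intro hz
        exact ⟨Fin.cast htc (t.equivFin ⟨z, hz⟩), by simp [q]⟩
    rw [← hq] at ht
    have hqrad := radical_eq_maximalIdeal_iff.2 ht
    obtain ⟨c, hc⟩ := exists_maximalIdeal_pow_le hrad
    obtain ⟨k, hk⟩ := exists_maximalIdeal_pow_le hqrad
    obtain ⟨L, hL⟩ := ENat.ne_top_iff_exists.1 (length_quotient_ne_top hk)
    refine le_of_multichoose_le (c := c + 1) (L := L) fun n => ?_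
    have h1 := le_length_quotient_pow hmem h (n + 1)
    have h2 : Ideal.span (Set.range q) ^ ((c + 1) * (n + 1) + 1) ≤
        Ideal.span (Set.range x) ^ (n + 1) := by
      refine (Ideal.pow_le_pow_right (show c * (n + 1) ≤ _ by nlinarith)).trans ?_
      rw [pow_mul, hx]
      refine Ideal.pow_right_mono ((Ideal.pow_right_mono ?_ c).trans hc) _
      rw [← hqrad]
      exact Ideal.le_radical
    have h3 := h1.trans ((length_quotient_anti h2).trans (length_quotient_span_pow_le q _))
    rw [sum_range_succ_multichoose, sum_range_succ_multichoose, ← hL] at h3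
    exact_mod_cast h3
  obtain rfl := le_antisymm hdν hνd
  exact ⟨x, hx⟩

end Krull

end MinimalReduction

/-! ### Lengths along the chain from K·J^n to K·I^n. -/

section HilbertFunction

open MvPolynomial IsLocalRing

variable {R : Type*} [CommRing R]

theorem FiberCone.IsReduction.exists_mul_pow_eq {I J : Ideal R} (hJ : FiberCone.IsReduction J I)
    (K : Ideal R) : ∃ n, K * I ^ (n + 1) = K * J * I ^ n := by
  obtain ⟨n, hn⟩ := hJ.2
  exact ⟨n, by rw [← hn, mul_assoc]⟩

theorem mul_pow_succ_eq_of_le {I J K : Ideal R} {s : ℕ} (h : K * I ^ (s + 1) = K * J * I ^ s)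
    {i : ℕ} (hi : s ≤ i) : K * I ^ (i + 1) = K * J * I ^ i := by
  obtain ⟨k, rfl⟩ := Nat.exists_eq_add_of_le hi
  rw [show s + k + 1 = (s + 1) + k by ring, pow_add, ← mul_assoc, h, mul_assoc, ← pow_add]

theorem covBy_of_quotLength_eq_one {A B : Ideal R} (hBA : B ≤ A)
    (h : FiberCone.quotLength A B = 1) : B ⋖ A :=
  (covBy_iff_quot_is_simple hBA).2 ((Module.length_eq_one_iff).1 h)

section Quasiregular

variable {d : ℕ} {x : Fin d → R}

theorem length_quotient_mul_span_pow (hx : IsQuasiRegularOn x Set.univ)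
    {𝔞 : Ideal R} (h𝔞 : Ideal.span (Set.range x) ≤ 𝔞) (n : ℕ) :
    Module.length R (R ⧸ 𝔞 * Ideal.span (Set.range x) ^ n) =
      Module.length R (R ⧸ Ideal.span (Set.range x) ^ n) +
        d.multichoose n * Module.length R (R ⧸ 𝔞) := by
  refine length_quotient_eq_of_forms x 1 n ?_ fun F hF => ?_
  · rw [Ideal.span_singleton_one, Ideal.mul_top]
    exact sup_eq_right.2 Ideal.mul_le_right
  · rw [mul_one]
    exact ⟨fun hev => coeff_mem_of_eval_mem_mul hx h𝔞 hF hev, fun hc => eval_mem_mul_span_pow hF hc⟩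

theorem length_quotient_span_pow (hx : IsQuasiRegularOn x Set.univ) (n : ℕ) :
    Module.length R (R ⧸ Ideal.span (Set.range x) ^ n) =
      (∑ i ∈ Finset.range n, d.multichoose i : ℕ) *
        Module.length R (R ⧸ Ideal.span (Set.range x)) := by
  induction n with
  | zero =>
    rw [Finset.range_zero, Finset.sum_empty, Nat.cast_zero, zero_mul, pow_zero, Ideal.one_eq_top,
      Module.length_eq_zero]
  | succ n ih =>
    rw [pow_succ', length_quotient_mul_span_pow hx le_rfl, ih, Finset.sum_range_succ, Nat.cast_add,
      add_mul]

theorem colength_span_pow {d : ℕ} {x : Fin d → R} (hx : IsQuasiRegularOn x Set.univ) (n : ℕ) :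
    FiberCone.colength (Ideal.span (Set.range x) ^ n) =
      (∑ i ∈ Finset.range n, d.multichoose i) * FiberCone.colength (Ideal.span (Set.range x)) := by
  rw [FiberCone.colength, length_quotient_span_pow hx, ENat.toNat_mul, ENat.toNat_natCast]
  rfl

end Quasiregular

section Local

variable [IsLocalRing R]

/-- Products a·b generate KI, so one of them lies outside KJ and generates the simple quotient
KI/KJ, which the maximal ideal kills. -/
theorem exists_mul_generator_of_covBy {I J K : Ideal R} (h : K * J ⋖ K * I) :
    ∃ a ∈ K, ∃ b ∈ I, K * I = K * J ⊔ Ideal.span {a * b} ∧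
      (∀ r ∈ maximalIdeal R, r * (a * b) ∈ K * J) := by
  obtain ⟨a, ha, b, hb, hab⟩ : ∃ a ∈ K, ∃ b ∈ I, a * b ∉ K * J := by
    by_contra! hcon
    exact h.lt.not_ge (Ideal.mul_le.2 hcon)
  have hcov : ∀ r, K * J ⊔ Ideal.span {r * (a * b)} = K * J ∨
      K * J ⊔ Ideal.span {r * (a * b)} = K * I := fun r =>
    h.eq_or_eq le_sup_left (sup_le h.le ((Ideal.span_singleton_le_iff_mem _).2
      (Ideal.mul_mem_left _ _ (Ideal.mul_mem_mul ha hb))))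
  refine ⟨a, ha, b, hb, ?_, fun r hr => ?_⟩
  · have := hcov 1
    rw [one_mul] at this
    exact (this.resolve_left fun hcon => hab
      (hcon ▸ Submodule.mem_sup_right (Ideal.mem_span_singleton_self _))).symm
  · refine (hcov r).elim (fun heq => ?_) fun heq => ?_
    · rw [← heq]; exact Submodule.mem_sup_right (Ideal.mem_span_singleton_self _)
    · exfalso
      have hmem : a * b ∈ K * J ⊔ Ideal.span {r * (a * b)} := heq ▸ Ideal.mul_mem_mul ha hb
      obtain ⟨u, hu, v, hv, huv⟩ := Submodule.mem_sup.1 hmem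
      obtain ⟨c, rfl⟩ := Ideal.mem_span_singleton'.1 hv
      have hunit : IsUnit (1 - c * r) := by
        by_contra hcon
        have h1 := Ideal.add_mem _ ((mem_maximalIdeal _).2 hcon) (Ideal.mul_mem_left _ c hr)
        rw [sub_add_cancel] at h1
        exact (mem_maximalIdeal _).1 h1 isUnit_one
      refine hab ((Ideal.unit_mul_mem_iff_mem _ hunit).1 ?_)
      rwa [show (1 - c * r) * (a * b) = u by linear_combination -huv]

variable [IsNoetherianRing R] {d : ℕ} {x : Fin d → R} {I K : Ideal R} {a b : R} {s : ℕ}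

theorem length_quotient_mul_pow_mul_pow_succ
    (hx : IsQuasiRegularOn x Set.univ) {k : ℕ}
    (hk : maximalIdeal R ^ k ≤ Ideal.span (Set.range x)) (hJK : Ideal.span (Set.range x) ≤ K)
    (hJI : Ideal.span (Set.range x) ≤ I) (ha : a ∈ K) (hb : b ∈ I)
    (hgen : K * I = K * Ideal.span (Set.range x) ⊔ Ideal.span {a * b})
    (hsoc : ∀ r ∈ maximalIdeal R, r * (a * b) ∈ K * Ideal.span (Set.range x))
    (hs : ∀ j < s, a * b ^ (j + 1) ∉ K * I ^ j * Ideal.span (Set.range x)) {j : ℕ} (hj : j < s)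
    (m : ℕ) :
    Module.length R (R ⧸ K * I ^ j * Ideal.span (Set.range x) ^ (m + 1)) =
      Module.length R (R ⧸ K * I ^ (j + 1) * Ideal.span (Set.range x) ^ m) + d.multichoose m := by
  rw [length_quotient_eq_of_forms x (a * b ^ (j + 1)) m (𝔞 := maximalIdeal R)
    (A := K * I ^ (j + 1) * Ideal.span (Set.range x) ^ m) (by
      rw [mul_pow_succ_mul_pow_eq_sup ha hb hgen, mul_comm (Ideal.span {_})]) fun F hF => ?_,
    length_quotient_maximalIdeal, mul_one]
  constructor
  · intro hmem
    rw [← map_residue_eq_zero_iff]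
    exact map_residue_eq_zero_of_mul_mem hx hk hJK hJI ha hb hgen hsoc hs hj hF hmem
  · intro hc
    have h1 : Ideal.span {a * b ^ (j + 1)} * maximalIdeal R ≤
        K * I ^ j * Ideal.span (Set.range x) := by
      rw [Ideal.span_singleton_mul_le_iff]
      intro r hr
      rw [show a * b ^ (j + 1) * r = r * (a * b) * b ^ j by ring, mul_right_comm]
      exact Ideal.mul_mem_mul (hsoc r hr) (Ideal.pow_mem_pow hb j)
    have h2 := Ideal.mul_mem_mul (Ideal.mem_span_singleton_self (a * b ^ (j + 1)))
      (eval_mem_mul_span_pow (x := x) hF hc)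
    rw [← mul_assoc] at h2
    rw [mul_comm (eval x F), pow_succ', ← mul_assoc]
    exact Ideal.mul_mono h1 le_rfl h2

/-- Factor number i of the chain is free on the monomials of degree n - 1 - i when i < s, and zero
when i ≥ s. -/
theorem length_quotient_mul_span_pow_eq_sum
    (hx : IsQuasiRegularOn x Set.univ) {k : ℕ}
    (hk : maximalIdeal R ^ k ≤ Ideal.span (Set.range x)) (hJK : Ideal.span (Set.range x) ≤ K)
    (hJI : Ideal.span (Set.range x) ≤ I) (ha : a ∈ K) (hb : b ∈ I)
    (hgen : K * I = K * Ideal.span (Set.range x) ⊔ Ideal.span {a * b})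
    (hsoc : ∀ r ∈ maximalIdeal R, r * (a * b) ∈ K * Ideal.span (Set.range x))
    (hs : ∀ j < s, a * b ^ (j + 1) ∉ K * I ^ j * Ideal.span (Set.range x))
    (hs' : K * I ^ (s + 1) = K * Ideal.span (Set.range x) * I ^ s) (n : ℕ) :
    Module.length R (R ⧸ K * Ideal.span (Set.range x) ^ n) =
      Module.length R (R ⧸ K * I ^ n) +
        (∑ i ∈ Finset.range n, if i < s then d.multichoose (n - 1 - i) else 0 : ℕ) := by
  suffices H : ∀ i ≤ n, Module.length R (R ⧸ K * Ideal.span (Set.range x) ^ n) =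
      Module.length R (R ⧸ K * I ^ i * Ideal.span (Set.range x) ^ (n - i)) +
        (∑ i ∈ Finset.range i, if i < s then d.multichoose (n - 1 - i) else 0 : ℕ) by
    have := H n le_rfl
    rwa [Nat.sub_self, pow_zero, mul_one] at this
  intro i
  induction i with
  | zero => intro _; rw [pow_zero, mul_one, Nat.sub_zero]; simp
  | succ i ih =>
    intro hi
    rw [ih (by omega), Finset.sum_range_succ, show n - i = n - (i + 1) + 1 by omega]
    split_ifs with his
    · rw [length_quotient_mul_pow_mul_pow_succ hx hk hJK hJI ha hb hgen hsoc hs his,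
        show n - (i + 1) = n - 1 - i by omega, Nat.cast_add]
      ring
    · rw [pow_succ', ← mul_assoc, mul_right_comm K, ← mul_pow_succ_eq_of_le hs' (by omega),
        add_zero]

end Local

end HilbertFunction

/-! ### The Hilbert function of K and I. -/

section Assembled

open IsLocalRing

variable {R : Type*} [CommRing R] [IsLocalRing R]

theorem coe_colength [IsNoetherianRing R] {A : Ideal R} {k : ℕ} (h : maximalIdeal R ^ k ≤ A) :
    (FiberCone.colength A : ℕ∞) = Module.length R (R ⧸ A) :=
  ENat.natCast_toNat (length_quotient_ne_top h)

/-- Both sides compute λ(R/KJ^n): through the chain up to K·I^n on the left, by quasi-regularity on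
the right. -/
theorem hilbertFunction_add_sum [IsNoetherianRing R] {d : ℕ} {x : Fin d → R} {I K : Ideal R}
    (hx : IsQuasiRegularOn x Set.univ)
    (hrad : (Ideal.span (Set.range x)).radical = maximalIdeal R) (hIK : I ≤ K)
    (hred : FiberCone.IsReduction (Ideal.span (Set.range x)) I)
    (hlen : FiberCone.quotLength (K * I) (K * Ideal.span (Set.range x)) = 1) (n : ℕ) :
    FiberCone.hilbertFunction K I n +
        (∑ i ∈ Finset.range n, if i < FiberCone.reductionNumber K (Ideal.span (Set.range x)) I
          then d.multichoose (n - 1 - i) else 0) =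
      (∑ i ∈ Finset.range n, d.multichoose i) * FiberCone.colength (Ideal.span (Set.range x)) +
        d.multichoose n * FiberCone.colength K := by
  have hJI := hred.1
  have hJK := hJI.trans hIK
  obtain ⟨k, hk⟩ := exists_maximalIdeal_pow_le hrad
  obtain ⟨a, ha, b, hb, hgen, hsoc⟩ :=
    exists_mul_generator_of_covBy (covBy_of_quotLength_eq_one (Ideal.mul_mono le_rfl hJI) hlen)
  -- The set of admissible exponents is nonempty because J is a reduction, so `sInf` is attained and
  -- is not the default value 0.
  have hs' : K * I ^ (_ + 1) = K * Ideal.span (Set.range x) * I ^ _ :=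
    Nat.sInf_mem (hred.exists_mul_pow_eq K)
  have hs : ∀ j < FiberCone.reductionNumber K (Ideal.span (Set.range x)) I,
      a * b ^ (j + 1) ∉ K * I ^ j * Ideal.span (Set.range x) := fun j hj hmem => by
    refine Nat.notMem_of_lt_sInf hj ?_
    rw [Set.mem_ofPred_eq, mul_pow_succ_eq_sup ha hb hgen]
    refine sup_eq_left.2 ((Ideal.span_singleton_le_iff_mem _).2 ?_)
    rwa [mul_right_comm]
  have key := length_quotient_mul_span_pow_eq_sum hx hk hJK hJI ha hb hgen hsoc hs hs' n
  have hkpow : ∀ {A B : Ideal R} (m : ℕ), maximalIdeal R ^ k ≤ A → maximalIdeal R ^ k ≤ B →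
      maximalIdeal R ^ (k + k * m) ≤ A * B ^ m := fun {A B} m hA hB => by
    rw [pow_add, pow_mul]
    exact Ideal.mul_mono hA (Ideal.pow_right_mono hB m)
  rw [length_quotient_mul_span_pow hx hJK, length_quotient_span_pow hx, ← coe_colength hk,
    ← coe_colength (hk.trans hJK), ← coe_colength (hkpow n (hk.trans hJK) (hk.trans hJI))] at key
  rw [FiberCone.hilbertFunction]
  exact_mod_cast key.symm

end Assembled

/-! ### The Hilbert–Serre theorem for families of ideals. -/

section StableFamilies

variable {R : Type*} [CommRing R]

/-- A family of ideals `P n` between `B n` and `A n` with `y * P n ≤ P (n + 1)` for `y ∈ l`. It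
stands for a graded submodule of `⨁ A n / B n` over the polynomial ring in the elements of `l`. -/
structure IsStableFamily (l : List R) (A B P : ℕ → Ideal R) : Prop where
  le_left : ∀ n, B n ≤ P n
  le_right : ∀ n, P n ≤ A n
  mul_mem : ∀ y ∈ l, ∀ n, ∀ z ∈ P n, y * z ∈ P (n + 1)

/-- The ascending chain condition for stable families. -/
def StableFamiliesACC (l : List R) (A B : ℕ → Ideal R) : Prop :=
  ∀ P : ℕ → ℕ → Ideal R, (∀ k, IsStableFamily l A B (P k)) → Monotone P →
    ∃ k₀, ∀ k, k₀ ≤ k → P k = P k₀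

/-- The elements of `A` that `y` multiplies into `B`. -/
def mulPreimage (y : R) (A B : Ideal R) : Ideal R :=
  A ⊓ Submodule.comap (LinearMap.mulLeft R y) B

/-- The ideals generated by `B n` and `y * A (n - 1)`. -/
def adjoinMul (y : R) (A B : ℕ → Ideal R) : ℕ → Ideal R
  | 0 => B 0
  | n + 1 => B (n + 1) ⊔ Ideal.span {y} * A n

theorem le_adjoinMul (y : R) (A B : ℕ → Ideal R) (n : ℕ) : B n ≤ adjoinMul y A B n := by
  cases n with
  | zero => exact le_rfl
  | succ n => exact le_sup_left

/-- Multiplication by `y` maps A onto (B + yA)/B, with kernel `mulPreimage y A B`. -/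
theorem length_quotient_add_length_quotient_mulPreimage {A B : Ideal R} {y : R} :
    Module.length R (R ⧸ B) + Module.length R (R ⧸ A) =
      Module.length R (R ⧸ (B ⊔ Ideal.span {y} * A)) +
        Module.length R (R ⧸ mulPreimage y A B) := by
  have hle : mulPreimage y A B ≤ A := inf_le_left
  rw [length_quotient_eq_add hle, add_left_comm, add_comm,
    length_quotient_eq_add_length_quotient_comap (LinearMap.mulLeft R y ∘ₗ A.subtype)
      (B := B) (A := B ⊔ Ideal.span {y} * A) ?_]
  · congr 2
    rw [FiberCone.quotLength]
    have : Submodule.comap (LinearMap.mulLeft R y ∘ₗ A.subtype) B =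
        Submodule.submoduleOf (mulPreimage y A B) A := by
      ext z
      exact ⟨fun h => ⟨z.2, h⟩, fun h => h.2⟩
    rw [this]
  · congr 1
    ext z
    rw [Ideal.mem_span_singleton_mul]
    constructor
    · rintro ⟨z, rfl⟩; exact ⟨z, z.2, rfl⟩
    · rintro ⟨z, hz, rfl⟩; exact ⟨⟨z, hz⟩, rfl⟩

-- Induction on the operators: the kernel and the cokernel of multiplication by `y` on ⨁ A n / B n
-- are killed by `y`, so they need one operator fewer. They are again quotients of stable families
-- and inherit the chain condition.
open PowerSeries in
theorem exists_polynomial_of_stableFamiliesACC (l : List R) :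
    ∀ A B : ℕ → Ideal R, IsStableFamily l A B A → IsStableFamily l A B B →
      (∀ n, Module.length R (R ⧸ B n) ≠ ⊤) → StableFamiliesACC l A B →
      ∃ p : Polynomial ℚ,
        PowerSeries.mk (fun n => (FiberCone.colength (B n) : ℚ) - FiberCone.colength (A n)) *
          (1 - X) ^ l.length = (p : PowerSeries ℚ) := by
  have hmono : ∀ {C D : Ideal R}, C ≤ D → Module.length R (R ⧸ C) ≠ ⊤ →
      Module.length R (R ⧸ D) ≠ ⊤ := fun h hC => ne_top_of_le_ne_top hC (length_quotient_anti h)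
  induction l with
  | nil =>
    intro A B hA _ _ hacc
    -- Without operators any family between B and A is stable. Stabilization of the families equal
    -- to A below k and to B from k on forces A n = B n for large n.
    obtain ⟨k₀, hk₀⟩ := hacc (fun k n => if n < k then A n else B n)
      (fun k => ⟨fun n => by split_ifs; exacts [hA.le_left n, le_rfl],
        fun n => by split_ifs; exacts [le_rfl, hA.le_left n], by simp⟩)
      (fun k k' hkk n => by
        dsimp only
        split_ifs with h1 h2 h2
        exacts [le_rfl, absurd (h1.trans_le hkk) h2, hA.le_left n, le_rfl])
    refine ⟨PowerSeries.trunc k₀ (PowerSeries.mk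
      (fun n => (FiberCone.colength (B n) : ℚ) - FiberCone.colength (A n))), ?_⟩
    ext n
    rw [List.length_nil, pow_zero, mul_one, Polynomial.coeff_coe, PowerSeries.coeff_trunc,
      PowerSeries.coeff_mk]
    split_ifs with hn
    · rfl
    · have := congrFun (hk₀ (n + 1) (by omega)) n
      simp only [Nat.lt_succ_self, if_true, if_neg hn] at this
      rw [this, sub_self]
  | cons y l ih =>
    intro A B hA hB hfin hacc
    have hyA : ∀ n, Ideal.span {y} * A n ≤ A (n + 1) := fun n => by
      rw [Ideal.span_singleton_mul_le_iff]
      exact fun z hz => hA.mul_mem y List.mem_cons_self n z hz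
    have hBA : ∀ n, B n ≤ A n := hA.le_left
    have hBK : ∀ n, B n ≤ mulPreimage y (A n) (B (n + 1)) := fun n z hz =>
      ⟨hBA n hz, hB.mul_mem y List.mem_cons_self n z hz⟩
    have hCA : ∀ n, adjoinMul y A B n ≤ A n := fun n => by
      cases n with
      | zero => exact hBA 0
      | succ n => exact sup_le (hBA _) (hyA n)
    obtain ⟨p, hp⟩ := ih (fun n => mulPreimage y (A n) (B (n + 1))) B
      ⟨hBK, fun n => le_rfl, fun w hw n z hz => ⟨hA.mul_mem w (List.mem_cons_of_mem _ hw) n z hz.1, by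
        have := hB.mul_mem w (List.mem_cons_of_mem _ hw) _ _ hz.2
        rwa [LinearMap.mulLeft_apply, mul_left_comm] at this⟩⟩
      ⟨fun n => le_rfl, hBK, fun w hw => hB.mul_mem w (List.mem_cons_of_mem _ hw)⟩ hfin
      (fun P hP hPm => hacc P (fun k => ⟨(hP k).le_left,
        fun n => ((hP k).le_right n).trans inf_le_left, fun w hw n z hz => by
          rcases List.mem_cons.1 hw with rfl | hw
          · exact (hP k).le_left _ ((hP k).le_right n hz).2
          · exact (hP k).mul_mem w hw n z hz⟩) hPm)
    obtain ⟨q, hq⟩ := ih A (adjoinMul y A B)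
      ⟨hCA, fun n => le_rfl, fun w hw => hA.mul_mem w (List.mem_cons_of_mem _ hw)⟩
      ⟨fun n => le_rfl, hCA, fun w hw n z hz => by
        cases n with
        | zero => exact le_adjoinMul y A B 1 (hB.mul_mem w (List.mem_cons_of_mem _ hw) 0 z hz)
        | succ n =>
          obtain ⟨u, hu, v, hv, rfl⟩ := Submodule.mem_sup.1 hz
          obtain ⟨a, ha, rfl⟩ := Ideal.mem_span_singleton_mul.1 hv
          rw [mul_add, mul_left_comm]
          exact Submodule.add_mem_sup (hB.mul_mem w (List.mem_cons_of_mem _ hw) _ u hu)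
            (Ideal.mul_mem_mul (Ideal.mem_span_singleton_self y)
              (hA.mul_mem w (List.mem_cons_of_mem _ hw) _ a ha))⟩
      (fun n => hmono (le_adjoinMul y A B n) (hfin n))
      (fun P hP hPm => hacc P (fun k => ⟨fun n => (le_adjoinMul y A B n).trans ((hP k).le_left n),
        (hP k).le_right, fun w hw n z hz => by
          rcases List.mem_cons.1 hw with rfl | hw
          · exact (hP k).le_left (n + 1) (Submodule.mem_sup_right (Ideal.mul_mem_mul
              (Ideal.mem_span_singleton_self w) ((hP k).le_right n hz)))
          · exact (hP k).mul_mem w hw n z hz⟩) hPm)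
    refine ⟨q - Polynomial.X * p, ?_⟩
    have hcoe : ∀ {C : Ideal R}, Module.length R (R ⧸ C) ≠ ⊤ →
        (FiberCone.colength C : ℕ∞) = Module.length R (R ⧸ C) := fun h => ENat.natCast_toNat h
    have key : ∀ n, (FiberCone.colength (B (n + 1)) : ℚ) + FiberCone.colength (A n) =
        FiberCone.colength (adjoinMul y A B (n + 1)) +
          FiberCone.colength (mulPreimage y (A n) (B (n + 1))) := fun n => by
      have := length_quotient_add_length_quotient_mulPreimage (A := A n) (B := B (n + 1)) (y := y)
      change _ = Module.length R (R ⧸ adjoinMul y A B (n + 1)) + _ at this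
      rw [← hcoe (hfin _), ← hcoe (hmono (hBA n) (hfin n)), ← hcoe (hmono (hBK n) (hfin n)),
        ← hcoe (hmono (le_adjoinMul y A B (n + 1)) (hfin _))] at this
      exact_mod_cast this
    have hser : PowerSeries.mk
          (fun n => (FiberCone.colength (B n) : ℚ) - FiberCone.colength (A n)) * (1 - X) =
        PowerSeries.mk
          (fun n => (FiberCone.colength (adjoinMul y A B n) : ℚ) - FiberCone.colength (A n)) -
        X * PowerSeries.mk (fun n => (FiberCone.colength (B n) : ℚ) -
          FiberCone.colength (mulPreimage y (A n) (B (n + 1)))) := by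
      rw [mul_sub, mul_one, mul_comm _ X]
      ext n
      cases n with
      | zero => simp [adjoinMul]
      | succ n =>
        simp only [map_sub, coeff_succ_X_mul, coeff_mk]
        linear_combination key n
    rw [List.length_cons, pow_succ', ← mul_assoc, hser, sub_mul, hq, mul_assoc, hp]
    push_cast
    rfl

end StableFamilies

/-! ### Existence of the Hilbert polynomial. -/

section HilbertPolynomial

open IsLocalRing

variable {R : Type*} [CommRing R]

/-- A stable family P gives the ideal ⨁ P n t^n of the Rees algebra, which is Noetherian. -/
theorem stableFamiliesACC_pow [IsNoetherianRing R] {I : Ideal R} {l : List R}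
    (hl : Ideal.span {y | y ∈ l} = I) :
    StableFamiliesACC l (fun n => I ^ n) (fun n => I ^ (n + 1)) := by
  intro P hP hPm
  have hmul : ∀ k i n, ∀ y ∈ I ^ i, ∀ z ∈ P k n, y * z ∈ P k (i + n) := by
    intro k i
    induction i with
    | zero => intro n y _ z hz; rw [zero_add]; exact Ideal.mul_mem_left _ _ hz
    | succ i ih =>
      intro n y hy z hz
      rw [pow_succ', ← hl] at hy
      refine Submodule.mul_induction_on hy (fun u hu v hv => ?_) fun u v hu hv => ?_
      · refine Submodule.span_induction (fun w hw => ?_) ?_ (fun w w' _ _ hw hw' => ?_)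
          (fun c w _ hw => ?_) hu
        · rw [mul_assoc, add_right_comm]
          exact (hP k).mul_mem w hw _ _ (ih n v (hl ▸ hv) z hz)
        · rw [zero_mul, zero_mul]; exact Ideal.zero_mem _
        · rw [add_mul, add_mul]; exact Ideal.add_mem _ hw hw'
        · rw [smul_eq_mul, mul_assoc, mul_assoc, ← mul_assoc w]; exact Ideal.mul_mem_left _ _ hw
      · rw [add_mul]; exact Ideal.add_mem _ hu hv
  let Q : ℕ →o Ideal (reesAlgebra I) :=
    { toFun := fun k =>
        { carrier := {f | ∀ n, f.1.coeff n ∈ P k n}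
          add_mem' := fun {f g} hf hg n => by
            rw [Subalgebra.coe_add, Polynomial.coeff_add]; exact Ideal.add_mem _ (hf n) (hg n)
          zero_mem' := fun n => by
            rw [Subalgebra.coe_zero, Polynomial.coeff_zero]; exact Ideal.zero_mem _
          smul_mem' := fun c f hf n => by
            rw [smul_eq_mul, Subalgebra.coe_mul, Polynomial.coeff_mul]
            refine Ideal.sum_mem _ fun ij hij => ?_
            rw [← Finset.HasAntidiagonal.mem_antidiagonal.1 hij]
            exact hmul k _ _ _ ((mem_reesAlgebra_iff I c.1).1 c.2 _) _ (hf _) }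
      monotone' := fun k k' hkk f hf n => hPm hkk n (hf n) }
  obtain ⟨k₀, hk₀⟩ := monotone_stabilizes_iff_noetherian.2 inferInstance Q
  refine ⟨k₀, fun k hk => funext fun n => le_antisymm (fun z hz => ?_) (hPm hk n)⟩
  have hmem : (⟨Polynomial.monomial n z, reesAlgebra.monomial_mem.2 ((hP k).le_right n hz)⟩ :
      reesAlgebra I) ∈ Q k := fun i => by
    change (Polynomial.monomial n z).coeff i ∈ P k i
    rw [Polynomial.coeff_monomial]
    split_ifs with h
    · exact h ▸ hz
    · exact Ideal.zero_mem _
  rw [← hk₀ k hk] at hmem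
  have := hmem n
  change (Polynomial.monomial n z).coeff n ∈ P k₀ n at this
  rwa [Polynomial.coeff_monomial, if_pos rfl] at this

variable [IsLocalRing R] [IsNoetherianRing R]

open PowerSeries in
theorem exists_isHilbertPolynomial {I : Ideal R} (hI : I.radical = maximalIdeal R) :
    ∃ P, FiberCone.IsHilbertPolynomial I P := by
  obtain ⟨t, ht⟩ := (IsNoetherian.noetherian I : I.FG)
  have hl : Ideal.span {y | y ∈ t.toList} = I := by
    rw [← ht]; congr 1; ext y; simp
  obtain ⟨k, hk⟩ := exists_maximalIdeal_pow_le hI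
  have hmul : ∀ y ∈ t.toList, ∀ n, ∀ z ∈ I ^ n, y * z ∈ I ^ (n + 1) := fun y hy n z hz => by
    rw [pow_succ']
    exact Ideal.mul_mem_mul (hl ▸ Ideal.subset_span hy) hz
  obtain ⟨p, hp⟩ := exists_polynomial_of_stableFamiliesACC t.toList (fun n => I ^ n)
    (fun n => I ^ (n + 1))
    ⟨fun n => Ideal.pow_le_pow_right n.le_succ, fun n => le_rfl, hmul⟩
    ⟨fun n => le_rfl, fun n => Ideal.pow_le_pow_right n.le_succ, fun y hy n => hmul y hy (n + 1)⟩
    (fun n => length_quotient_ne_top (k := k * (n + 1)) (by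
      rw [pow_mul]; exact Ideal.pow_right_mono hk _)) (stableFamiliesACC_pow hl)
  -- Passing from λ(I^n/I^{n+1}) to the sums λ(R/I^n) adds one factor 1 - X to the denominator.
  have hser : PowerSeries.mk (fun n => (FiberCone.colength (I ^ n) : ℚ)) * (1 - X) =
      X * PowerSeries.mk (fun n => (FiberCone.colength (I ^ (n + 1)) : ℚ) -
        FiberCone.colength (I ^ n)) := by
    rw [mul_sub, mul_one, mul_comm _ X]
    ext n
    cases n with
    | zero =>
      have h0 : FiberCone.colength (⊤ : Ideal R) = 0 := by
        rw [FiberCone.colength, Module.length_eq_zero]; rfl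
      simp [h0]
    | succ n => simp only [map_sub, coeff_succ_X_mul, coeff_mk]
  set e := t.toList.length
  have hfin : PowerSeries.mk (fun n => (FiberCone.colength (I ^ n) : ℚ)) =
      ((Polynomial.X * p : Polynomial ℚ) : PowerSeries ℚ) * (invOneSubPow ℚ (e + 1)).val := by
    have h1 : (1 - X) ^ (e + 1) * (invOneSubPow ℚ (e + 1)).val = 1 := by
      rw [← invOneSubPow_inv_eq_one_sub_pow]
      exact (invOneSubPow ℚ (e + 1)).inv_val
    rw [Polynomial.coe_mul, Polynomial.coe_X, ← hp, ← mul_assoc X, ← hser, mul_assoc _ (1 - X),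
      ← pow_succ', mul_assoc, h1, mul_one]
  refine ⟨(Polynomial.X * p).hilbertPoly (e + 1), Filter.eventually_atTop.2
    ⟨(Polynomial.X * p).natDegree + 1, fun n hn => ?_⟩⟩
  rw [← Polynomial.coeff_mul_invOneSubPow_eq_hilbertPoly_eval _ hn, ← hfin, coeff_mk]

end HilbertPolynomial

/-! ### The multiplicity as the colength of a reduction. -/

section Multiplicity

open Polynomial Filter

/-- A shift of the argument by `c` changes neither degree nor leading coefficient, so the limits of
the quotients of the polynomials decide both claims. -/
theorem degree_eq_and_leadingCoeff_eq_of_eventually_le {P Q : ℚ[X]} {c : ℕ}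
    (hQ : ∀ᶠ n : ℕ in atTop, 0 < Q.eval (n : ℚ))
    (h1 : ∀ᶠ n : ℕ in atTop, P.eval (n : ℚ) ≤ Q.eval (n : ℚ))
    (h2 : ∀ᶠ n : ℕ in atTop, Q.eval (n : ℚ) ≤ P.eval ((n + c : ℕ) : ℚ)) :
    P.degree = Q.degree ∧ P.leadingCoeff = Q.leadingCoeff := by
  set P' := P.comp (X + C (c : ℚ)) with hP'
  have hev : ∀ n : ℕ, P'.eval (n : ℚ) = P.eval ((n + c : ℕ) : ℚ) := fun n => by simp [P']
  have hdeg' : P'.degree = P.degree := by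
    rw [hP', degree_comp (by rw [degree_X_add_C]; exact zero_lt_one), degree_X_add_C, mul_one]
  have hlead' : P'.leadingCoeff = P.leadingCoeff := by
    rw [hP', leadingCoeff_comp (by rw [natDegree_X_add_C]; exact one_ne_zero), leadingCoeff_X_add_C,
      one_pow, mul_one]
  have hP0 : ∀ᶠ n : ℕ in atTop, 0 < P.eval (n : ℚ) := by
    obtain ⟨N, hN⟩ := eventually_atTop.1 (hQ.and h2)
    refine eventually_atTop.2 ⟨N + c, fun n hn => ?_⟩
    have := hN (n - c) (by omega)
    rw [Nat.sub_add_cancel (by omega)] at this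
    exact this.1.trans_le this.2
  have hcast := tendsto_natCast_atTop_atTop (R := ℚ)
  have hdeg : P.degree = Q.degree := by
    rcases lt_trichotomy P.degree Q.degree with hlt | heq | hgt
    · exfalso
      have ht := (div_tendsto_atTop_zero_of_degree_lt P' Q (hdeg' ▸ hlt)).comp hcast
      refine absurd (ge_of_tendsto ht (b := 1) ?_) (by norm_num)
      filter_upwards [hQ, h2] with n ha hb
      rw [Function.comp_apply, one_le_div ha, hev]
      exact hb
    · exact heq
    · exfalso
      have ht := (div_tendsto_atTop_zero_of_degree_lt Q P hgt).comp hcast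
      refine absurd (ge_of_tendsto ht (b := 1) ?_) (by norm_num)
      filter_upwards [hP0, h1] with n ha hb
      rw [Function.comp_apply, one_le_div ha]
      exact hb
  refine ⟨hdeg, ?_⟩
  have ht := (div_tendsto_atTop_leadingCoeff_div_of_degree_eq P Q hdeg).comp hcast
  have ht' := (div_tendsto_atTop_leadingCoeff_div_of_degree_eq P' Q (hdeg'.trans hdeg)).comp hcast
  rw [hlead'] at ht'
  have hQ0 : Q.leadingCoeff ≠ 0 := by
    rw [leadingCoeff_ne_zero]
    rintro rfl
    obtain ⟨n, hn⟩ := hQ.exists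
    simp at hn
  rw [← div_eq_one_iff_eq hQ0]
  apply le_antisymm
  · refine le_of_tendsto ht ?_
    filter_upwards [hQ, h1] with n ha hb
    rw [Function.comp_apply, div_le_one ha]
    exact hb
  · refine ge_of_tendsto ht' ?_
    filter_upwards [hQ, h2] with n ha hb
    rw [Function.comp_apply, one_le_div ha, hev]
    exact hb

open IsLocalRing

variable {R : Type*} [CommRing R] [IsLocalRing R] [IsNoetherianRing R]

theorem colength_anti {A B : Ideal R} {k : ℕ} (hk : maximalIdeal R ^ k ≤ B) (h : B ≤ A) :
    FiberCone.colength A ≤ FiberCone.colength B :=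
  ENat.toNat_le_toNat (length_quotient_anti h) (length_quotient_ne_top hk)

/-- The multiplicity of `I` is the colength of a reduction generated by a quasi-regular system. -/
theorem hilbertMultiplicity_eq_colength {d : ℕ} {x : Fin d → R} {I : Ideal R}
    (hx : IsQuasiRegularOn x Set.univ) (hI : I.radical = maximalIdeal R)
    (hred : FiberCone.IsReduction (Ideal.span (Set.range x)) I) :
    FiberCone.hilbertMultiplicity I d = FiberCone.colength (Ideal.span (Set.range x)) := by
  obtain ⟨P, hP⟩ := exists_isHilbertPolynomial hI
  have hrad := radical_eq_of_isReduction hI hred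
  obtain ⟨k, hk⟩ := exists_maximalIdeal_pow_le hrad
  set J := Ideal.span (Set.range x) with hJ
  set L := FiberCone.colength J with hLdef
  have hJm : J ≤ maximalIdeal R := hrad ▸ Ideal.le_radical
  have hL : 0 < L := by
    have h1 := colength_anti hk hJm
    rw [FiberCone.colength, length_quotient_maximalIdeal] at h1
    exact h1
  have hkpow : ∀ n, maximalIdeal R ^ (k * n) ≤ J ^ n := fun n => by
    rw [pow_mul]; exact Ideal.pow_right_mono hk n
  obtain ⟨c, hc⟩ := hred.2
  -- With I^n ⊇ J^n this squeezes the Hilbert polynomial of I between shifts of that of J.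
  have hIJ : ∀ n, I ^ (n + c) ≤ J ^ n := fun n => by
    have : I ^ (n + c) = J ^ n * I ^ c := by
      induction n with
      | zero => simp
      | succ n ih => rw [pow_succ, mul_assoc, hc, pow_succ, ← mul_assoc, ← ih]; ring
    rw [this]
    exact Ideal.mul_le_left
  let Q : ℚ[X] := C ((L : ℚ) / d.factorial) * ascPochhammer ℚ d
  have hfac : (d.factorial : ℚ) ≠ 0 := by exact_mod_cast d.factorial_ne_zero
  have hc0 : (L : ℚ) / d.factorial ≠ 0 := div_ne_zero (by exact_mod_cast hL.ne') hfac
  -- The value n = 0 is excluded: for d = 0 the polynomial `Q` is the constant L > 0, while J^0 has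
  -- colength 0.
  have hQev : ∀ n : ℕ, 1 ≤ n → Q.eval (n : ℚ) = FiberCone.colength (J ^ n) := fun n hn => by
    obtain ⟨n, rfl⟩ := Nat.exists_eq_add_of_le' hn
    rw [colength_span_pow hx, sum_range_succ_multichoose, eval_mul, eval_C,
      ascPochhammer_nat_eq_natCast_ascFactorial, Nat.ascFactorial_eq_factorial_mul_choose,
      Nat.multichoose_eq, show d + 1 + n - 1 = n + d by omega, Nat.choose_symm_add, ← hJ, ← hLdef]
    push_cast
    field_simp
  have hQpos : ∀ᶠ n : ℕ in atTop, 0 < Q.eval (n : ℚ) :=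
    Filter.eventually_atTop.2 ⟨1, fun n hn => by
      rw [hQev n hn]
      have h1 := colength_anti (hkpow n) (Ideal.pow_le_self (by omega) : J ^ n ≤ J)
      exact_mod_cast hL.trans_le h1⟩
  have h := degree_eq_and_leadingCoeff_eq_of_eventually_le (P := P) (Q := Q) (c := c) hQpos
    (by
      filter_upwards [hP, Filter.eventually_ge_atTop 1] with n hn hn1
      rw [hn, hQev n hn1]
      exact_mod_cast colength_anti (hkpow n) (Ideal.pow_right_mono hred.1 n))
    (by
      filter_upwards [(Filter.tendsto_add_atTop_nat c).eventually hP,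
        Filter.eventually_ge_atTop 1] with n hn hn1
      rw [hn, hQev n hn1]
      exact_mod_cast colength_anti ((hkpow (n + c)).trans (Ideal.pow_right_mono hred.1 _)) (hIJ n))
  have hQdeg : Q.natDegree = d := by
    rw [natDegree_C_mul hc0, ascPochhammer_natDegree]
  have hQlead : Q.leadingCoeff = (L : ℚ) / d.factorial := by
    rw [leadingCoeff_mul, leadingCoeff_C, (monic_ascPochhammer ℚ d).leadingCoeff, mul_one]
  have hPdeg : P.natDegree = d := (natDegree_eq_of_degree_eq h.1).trans hQdeg
  rw [FiberCone.hilbertMultiplicity, hP.hilbertPolynomial_eq, ← hPdeg, coeff_natDegree, h.2, hQlead,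
    hPdeg, mul_div_cancel₀ _ hfac]

end Multiplicity

/-! ### Generating functions. -/

section HilbertSeries

open PowerSeries

/-- The generating function of the dimensions of the spaces of forms in `d` variables. -/
noncomputable def multichooseSeries (d : ℕ) : ℚ⟦X⟧ :=
  PowerSeries.mk fun n => (d.multichoose n : ℚ)

theorem multichooseSeries_mul_one_sub_X (d : ℕ) :
    multichooseSeries (d + 1) * (1 - X) = multichooseSeries d := by
  rw [mul_sub, mul_one, mul_comm _ X]
  ext n
  cases n with
  | zero => simp [multichooseSeries]
  | succ n =>
    simp only [multichooseSeries, map_sub, coeff_succ_X_mul, coeff_mk]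
    rw [Nat.multichoose_succ_succ]
    push_cast
    ring

theorem multichooseSeries_mul_one_sub_X_pow (d : ℕ) : multichooseSeries d * (1 - X) ^ d = 1 := by
  induction d with
  | zero =>
    rw [pow_zero, mul_one]
    ext n
    cases n <;> simp [multichooseSeries, coeff_one]
  | succ d ih => rw [pow_succ', ← mul_assoc, multichooseSeries_mul_one_sub_X, ih]

/-- The recursion turns into L·X/(1-X)^{d+1} + κ/(1-X)^d - (X + … + X^s)/(1-X)^d. After
multiplication by (1-X)^{d+1} the geometric sum telescopes to X - X^{s+1}. -/
theorem mk_mul_one_sub_X_pow_of_add_sum {d s : ℕ} {H : ℕ → ℕ} {L κ : ℕ}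
    (h : ∀ n, H n + (∑ i ∈ Finset.range n, if i < s then d.multichoose (n - 1 - i) else 0) =
      (∑ i ∈ Finset.range n, d.multichoose i) * L + d.multichoose n * κ) :
    PowerSeries.mk (fun n => (H n : ℚ)) * (1 - X) ^ (d + 1) =
      C (κ : ℚ) + C ((L : ℚ) - 1 - κ) * X + X ^ (s + 1) := by
  have hmk : PowerSeries.mk (fun n => (H n : ℚ)) = C (L : ℚ) * (X * multichooseSeries (d + 1)) +
      C (κ : ℚ) * multichooseSeries d -
        ∑ i ∈ Finset.range s, X ^ (i + 1) * multichooseSeries d := by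
    ext n
    have hsum : coeff n (∑ i ∈ Finset.range s, X ^ (i + 1) * multichooseSeries d) =
        ((∑ i ∈ Finset.range n, if i < s then d.multichoose (n - 1 - i) else 0 : ℕ) : ℚ) := by
      rw [map_sum, ← Finset.sum_filter]
      simp only [multichooseSeries, coeff_X_pow_mul', coeff_mk]
      rw [← Finset.sum_filter, Nat.cast_sum]
      refine Finset.sum_congr ?_ fun i _ => by rw [show n - (i + 1) = n - 1 - i by omega]
      ext i
      simp only [Finset.mem_filter, Finset.mem_range]
      omega
    have hX : coeff n (X * multichooseSeries (d + 1)) =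
        ((∑ i ∈ Finset.range n, d.multichoose i : ℕ) : ℚ) := by
      cases n with
      | zero => simp
      | succ n => rw [coeff_succ_X_mul, sum_range_succ_multichoose, multichooseSeries, coeff_mk]
    have hn := congrArg (Nat.cast (R := ℚ)) (h n)
    push_cast at hn
    rw [map_sub, map_add, coeff_C_mul, coeff_C_mul, hsum, hX, multichooseSeries, coeff_mk, coeff_mk]
    push_cast
    linear_combination hn
  have hgeom := geom_sum_mul_neg (X : ℚ⟦X⟧) s
  have h1 := multichooseSeries_mul_one_sub_X_pow (d + 1)
  have h0 := multichooseSeries_mul_one_sub_X_pow d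
  have hs : ∑ i ∈ Finset.range s, X ^ (i + 1) * multichooseSeries d =
      (∑ i ∈ Finset.range s, X ^ i) * (X * multichooseSeries d) := by
    rw [Finset.sum_mul]
    exact Finset.sum_congr rfl fun i _ => by ring
  rw [hmk, hs, map_sub, map_sub, map_one]
  linear_combination (C (L : ℚ) * X) * h1 +
    (C (κ : ℚ) * (1 - X) - (∑ i ∈ Finset.range s, X ^ i) * X * (1 - X)) * h0 - X * hgeom

end HilbertSeries

theorem proposition5p2 {R : Type*} [CommRing R] [IsLocalRing R]
    [Infinite (IsLocalRing.ResidueField R)]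
    (hCM : FiberCone.IsCohenMacaulayLocal R)
    (d : ℕ) (hd : ringKrullDim R = d)
    (I K J : Ideal R)
    (hI : I.radical = IsLocalRing.maximalIdeal R)
    (hIK : FiberCone.HasAlmostMinimalMultiplicity I K)
    (hγ : (d : ℕ∞) ≤ FiberCone.gamma I + 1)
    (hJ : FiberCone.IsMinimalReduction J I)
    (s : ℕ) (hs : s = FiberCone.reductionNumber K J I) :
    PowerSeries.mk (fun n : ℕ => (FiberCone.hilbertFunction K I n : ℚ)) =
      (PowerSeries.C (FiberCone.colength K : ℚ) +
          PowerSeries.C (FiberCone.hilbertMultiplicity I d - 1 - (FiberCone.colength K : ℚ)) *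
            PowerSeries.X +
          PowerSeries.X ^ (s + 1)) *
        ((1 - PowerSeries.X) ^ (d + 1))⁻¹ := by
  have := hCM.1
  obtain ⟨x, rfl⟩ := exists_generators_of_isMinimalReduction hd hI hJ
  have hrad := radical_eq_of_isReduction hI hJ.1
  have hx := isQuasiRegularOn_of_isCohenMacaulayLocal hCM hd hrad
  subst hs
  rw [PowerSeries.eq_mul_inv_iff_mul_eq (by simp), hilbertMultiplicity_eq_colength hx hI hJ.1]
  exact mk_mul_one_sub_X_pow_of_add_sum
    (hilbertFunction_add_sum hx hrad hIK.1 hJ.1 (hIK.2 _ hJ))
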